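/- **Setting.** Let $k\ge 0$. A $k$-graph is a nonempty countable small category $\Lambda$ with a functor $d:\Lambda\to\mathbb N^k$ (we identify $\Lambda$ with its set of morphisms, called paths, and objects with identity morphisms) such that whenever $d(\lambda)=m+n$ there are unique $\mu,\nu$ with $d(\mu)=m$, $d(\nu)=n$ and $\lambda=\mu\nu$. Write $\Lambda^n=d^{-1}(n)$, and $s,r$ for domain and codomain. $\Lambda$ is row-finite with no sources if $v\Lambda^n=\{\lambda\in\Lambda^n: r(\lambda)=v\}$ is finite and nonempty for all $v\in\Lambda^0$, $n\in\mathbb N^k$. An $A$-$B$ $C^*$-correspondence is a right Hilbert $B$-module $E$ with a $*$-homomorphism $\phi:A\to\mathcal L(E)$. A $\Lambda$-system $(A,X,\chi)$ of $C^*$-correspondences consists of a $C^*$-algebra $A_v$ for each $v\in\Lambda^0$, an $A_{r(\lambda)}$-$A_{s(\lambda)}$ correspondence $X_\lambda$ with left action $\phi_\lambda$ for each $\lambda\in\Lambda$, where $X_v$ is the identity correspondence $A_v$ for $v\in\Lambda^0$, and, for all $\alpha,\beta$ with $s(\alpha)=r(\beta)$, a map of correspondences $\chi_{\alpha,\beta}:X_\alpha\otimes_{A_{s(\alpha)}}X_\beta\to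 X_{\alpha\beta}$, which is an isomorphism if $\alpha\notin\Lambda^0$, such that $\chi_{r(\lambda),\lambda}(a\otimes x)=\phi_\lambda(a)x$, $\chi_{\lambda,s(\lambda)}(x\otimes a)=x\cdot a$, and $\chi_{\alpha\beta,\gamma}(\chi_{\alpha,\beta}\otimes 1)=\chi_{\alpha,\beta\gamma}(1\otimes\chi_{\beta,\gamma})$. It is regular if $\Lambda$ is row-finite with no sources, each $X_\lambda$ is nondegenerate and full, and each $\phi_\lambda$ is injective with values in $\mathcal K(X_\lambda)$. A representation of $X$ in a $C^*$-algebra $B$ is a pair $(\rho,\pi)$ of families of linear maps $\rho_\lambda:X_\lambda\to B$ and $*$-homomorphisms $\pi_v:A_v\to B$ such that (1) $\rho_v=\pi_v$ for $v\in\Lambda^0$; (2) for $x\in X_\alpha$, $y\in X_\beta$, $\rho_\alpha(x)\rho_\beta(y)$ is $\rho_{\alpha\beta}(\chi_{\alpha,\beta}(x\otimes y))$ if $s(\alpha)=r(\beta)$ and $0$ otherwise; (3) if $d(\alpha)=d(\beta)$, then $\rho_\alpha(x)^*\rho_\beta(y)$ is $\pi_{s(\alpha)}(\langle x,y\rangle)$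 if $\alpha=\beta$ and $0$ otherwise. It is universal if for every representation $(\rho',\pi')$ of $X$ in a $C^*$-algebra $C$ there is a unique $*$-homomorphism $\Phi:B\to C$ with $\Phi\circ\rho_\lambda=\rho'_\lambda$ for all $\lambda\in\Lambda$ and $\Phi\circ\pi_v=\pi'_v$ for all $v\in\Lambda^0$. Let $A=\bigoplus_{v}A_v$ ($c_0$-direct sum) and regard each $X_\lambda$ as an $A$-$A$ correspondence. Let $Y_n=\bigoplus_{\lambda\in\Lambda^n}X_\lambda$ ($\ell^2$-direct sum), so that $Y_0=A$, with inclusions $\iota_\lambda:X_\lambda\to Y_{d(\lambda)}$ and $\iota_v:A_v\to A=Y_0$. Then $Y=Y_X=\bigsqcup_{n\in\mathbb N^k}Y_n$ is the product system over $\mathbb N^k$ with multiplication determined by $\iota_\alpha(x)\iota_\beta(y)=\iota_{\alpha\beta}(\chi_{\alpha,\beta}(x\otimes y))$ if $s(\alpha)=r(\beta)$, and $0$ otherwise. A representation of $Y$ in a $C^*$-algebra $B$ is a map $\psi:Y\to B$, with restrictions $\psi_n=\psi|_{Y_n}$, such that $\psi_0:A\to B$ is a $*$-homomorphism, each $\psi_n$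 is linear with $\psi_n(a\cdot y)=\psi_0(a)\psi_n(y)$, $\psi_n(y\cdot a)=\psi_n(y)\psi_0(a)$ and $\psi_0(\langle y,z\rangle)=\psi_n(y)^*\psi_n(z)$, and $\psi_m(x)\psi_n(y)=\psi_{m+n}(xy)$. The Toeplitz algebra $\mathcal T_Y$ is a $C^*$-algebra generated by the image of a representation $i_Y:Y\to\mathcal T_Y$ such that for every representation $\psi$ of $Y$ in a $C^*$-algebra $B$ there is a $*$-homomorphism $\psi_*:\mathcal T_Y\to B$ with $\psi_*\circ i_Y=\psi$. **Proposition 3.2.3.** Let $\Lambda$ be a row-finite $k$-graph with no sources, let $X$ be a regular $\Lambda$-system of $C^*$-correspondences, and let $Y=Y_X$. 1. If $\psi$ is a representation of $Y$ in a $C^*$-algebra $B$, then $\rho^\psi_\alpha:=\psi\circ\iota_\alpha$ $(\alpha\in\Lambda)$ and $\pi^\psi_v:=\psi\circ\iota_v$ $(v\in\Lambda^0)$ define a representation $(\rho^\psi,\pi^\psi)$ of $X$ in $B$. 2. If $(\rho,\pi)$ is a representation of $X$ in a $C^*$-algebra $B$, then there is a unique representation $\psi^{(\rho,\pi)}$ of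 $Y$ in $B$ such that $\psi^{(\rho,\pi)}(\iota_\alpha(x))=\rho_\alpha(x)$ for all $\alpha\in\Lambda$ and $x\in X_\alpha$. These constructions are mutually inverse: $\psi^{(\rho^\psi,\pi^\psi)}=\psi$ for every representation $\psi$ of $Y$, and $(\rho^{\psi^{(\rho,\pi)}},\pi^{\psi^{(\rho,\pi)}})=(\rho,\pi)$ for every representation $(\rho,\pi)$ of $X$. Moreover, the Toeplitz algebra $(\mathcal T_Y,i_Y)$ exists, and the representation $(\rho^{i_Y},\pi^{i_Y})$ of $X$ in $\mathcal T_Y$ is universal. -/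

import Mathlib

open scoped ENNReal
open CategoryTheory Filter Topology

universe u

noncomputable section

/-- A `C*`-correspondence from `A` to `B`: a right Hilbert `B`-module together with a
`*`-homomorphism `φ` from `A` into its adjointable operators.

The inner product is linear in the second variable, and `x · b` is written `rsmul x b`.
Positivity of an element of a `C*`-algebra is expressed as being of the form `b* b`; definiteness
of the inner product is contained in `norm_sq`.  A map with an adjoint is automatically bounded
and right `B`-linear, so `inner_φ` says precisely that `φ a` is adjointable with adjoint
`φ a*`. -/
structure Corr (A B : Type u) [NonUnitalCStarAlgebra A] [NonUnitalCStarAlgebra B] where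
  carrier : Type u
  [normedAddCommGroup : NormedAddCommGroup carrier]
  [normedSpace : NormedSpace ℂ carrier]
  [completeSpace : CompleteSpace carrier]
  /-- the right action `x · b` -/
  rsmul : carrier →ₗ[ℂ] B →ₗ[ℂ] carrier
  rsmul_mul : ∀ x b c, rsmul x (b * c) = rsmul (rsmul x b) c
  /-- the `B`-valued inner product -/
  inner : carrier → carrier →ₗ[ℂ] B
  inner_rsmul : ∀ x y b, inner x (rsmul y b) = inner x y * b
  star_inner : ∀ x y, star (inner x y) = inner y x
  inner_self_pos : ∀ x, ∃ b, inner x x = star b * b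
  norm_sq : ∀ x, ‖x‖ ^ 2 = ‖inner x x‖
  /-- the left action `φ a x = a · x` -/
  φ : A →ₗ[ℂ] carrier →ₗ[ℂ] carrier
  φ_mul : ∀ a b x, φ (a * b) x = φ a (φ b x)
  inner_φ : ∀ a x y, inner (φ a x) y = inner x (φ (star a) y)

namespace Corr

instance (A B : Type u) [NonUnitalCStarAlgebra A] [NonUnitalCStarAlgebra B] :
    CoeSort (Corr A B) (Type u) := ⟨Corr.carrier⟩

attribute [instance] Corr.normedAddCommGroup Corr.normedSpace Corr.completeSpace

section Basic

variable {A B : Type u} [NonUnitalCStarAlgebra A] [NonUnitalCStarAlgebra B] (E : Corr A B)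

/-- The closed linear span of `{φ a x}` is everything. -/
def IsNondegenerate : Prop :=
  Dense (Submodule.span ℂ {y : E | ∃ (a : A) (x : E), y = E.φ a x} : Set E)

/-- The range of the inner product generates `B` as a closed two-sided ideal.  (The linear span of
the range is already a two-sided ideal.) -/
def IsFull : Prop :=
  Dense (Submodule.span ℂ {b : B | ∃ x y : E, b = E.inner x y} : Set B)

/-- `T` lies in `𝒦(E)`, the closure in the operator norm of the linear span of the rank-one
operators `θ_{x,y} : z ↦ x · ⟨y, z⟩`. -/
def IsCompactOp (T : E →ₗ[ℂ] E) : Prop :=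
  ∀ ε : ℝ, 0 < ε → ∃ (n : ℕ) (x y : Fin n → E),
    ∀ z : E, ‖T z - ∑ i, E.rsmul (x i) (E.inner (y i) z)‖ ≤ ε * ‖z‖

end Basic

end Corr

section Semi

attribute [local instance] CStarAlgebra.spectralOrder CStarAlgebra.spectralOrderedRing

variable {B : Type u} [NonUnitalCStarAlgebra B] {V : Type u} [AddCommGroup V] [Module ℂ V]

/-- A positive semidefinite `B`-valued form on a complex vector space with a right `B`-action. -/
structure IsSemiInner (rs : V → B → V) (h : V → V →ₗ[ℂ] B) : Prop where
  rsmul : ∀ x y b, h x (rs y b) = h x y * b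
  symm : ∀ x y, star (h x y) = h y x
  pos : ∀ x, ∃ b, h x x = star b * b

variable {rs : V → B → V} {h : V → V →ₗ[ℂ] B}

lemma IsSemiInner.nonneg (H : IsSemiInner rs h) (x : V) : 0 ≤ h x x := by
  obtain ⟨b, hb⟩ := H.pos x
  rw [hb]; exact star_mul_self_nonneg b

lemma IsSemiInner.add_left (H : IsSemiInner rs h) (x y z : V) : h (x + y) z = h x z + h y z := by
  rw [← H.symm, map_add, star_add, H.symm, H.symm]

lemma IsSemiInner.sub_left (H : IsSemiInner rs h) (x y z : V) : h (x - y) z = h x z - h y z := by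
  rw [← H.symm, map_sub, star_sub, H.symm, H.symm]

lemma IsSemiInner.smul_left (H : IsSemiInner rs h) (c : ℂ) (x z : V) :
    h (c • x) z = star c • h x z := by
  rw [← H.symm, map_smul, star_smul, H.symm]

lemma IsSemiInner.rsmul_left (H : IsSemiInner rs h) (x y : V) (b : B) :
    h (rs x b) y = star b * h x y := by
  rw [← H.symm, H.rsmul, star_mul, H.symm]

lemma IsSemiInner.norm_le (H : IsSemiInner rs h) (x y : V) :
    ‖h x y‖ ≤ √‖h x x‖ * √‖h y y‖ := by
  have key : ∀ t : ℝ, ‖h x x‖ < t → ‖h x y‖ ^ 2 ≤ t * ‖h y y‖ := by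
    intro t ht
    have ht0 : 0 < t := (norm_nonneg _).trans_lt ht
    set b := h x y with hb
    have h1 : 0 ≤ h (rs x b - (t : ℂ) • y) (rs x b - (t : ℂ) • y) := H.nonneg _
    have e : h (rs x b - (t : ℂ) • y) (rs x b - (t : ℂ) • y)
        = star b * h x x * b - (2 * t) • (star b * b) + (t * t) • h y y := by
      rw [H.sub_left, map_sub, map_sub, H.rsmul, H.rsmul, H.rsmul_left, H.smul_left, H.smul_left,
        map_smul, map_smul, H.rsmul_left, ← H.symm x y, ← hb]
      simp only [Complex.star_def, Complex.conj_ofReal, Complex.coe_smul, smul_mul_assoc, smul_smul]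
      rw [two_mul, add_smul]
      abel
    have h2 : star b * h x x * b ≤ t • (star b * b) := by
      calc star b * h x x * b ≤ ‖h x x‖ • (star b * b) :=
            CStarAlgebra.star_left_conjugate_le_norm_smul (hb := .of_nonneg (H.nonneg x))
        _ ≤ t • (star b * b) := by
            have := star_mul_self_nonneg b
            gcongr
    have h3 : t • (star b * b) ≤ (t * t) • h y y := by
      rw [e] at h1
      have : (0 : B) ≤ t • (star b * b) - (2 * t) • (star b * b) + (t * t) • h y y :=
        h1.trans (by gcongr)
      rw [two_mul, add_smul] at this
      have h4 := add_le_add_left this (t • (star b * b))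
      simpa [sub_eq_add_neg, add_assoc, add_comm, add_left_comm] using h4
    have h5 : ‖t • (star b * b)‖ ≤ ‖(t * t) • h y y‖ :=
      CStarAlgebra.norm_le_norm_of_nonneg_of_le
        (smul_nonneg ht0.le (star_mul_self_nonneg b)) h3
    rw [norm_smul, norm_smul, CStarRing.norm_star_mul_self, Real.norm_of_nonneg ht0.le,
      Real.norm_of_nonneg (by positivity), mul_assoc] at h5
    rw [pow_two]
    exact le_of_mul_le_mul_left h5 ht0
  have k2 : ‖h x y‖ ^ 2 ≤ ‖h x x‖ * ‖h y y‖ := by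
    refine le_of_forall_pos_le_add fun ε hε => ?_
    have hp : 0 < ‖h y y‖ + 1 := by positivity
    refine (key (‖h x x‖ + ε / (‖h y y‖ + 1)) (by have : 0 < ε / (‖h y y‖ + 1) := by positivity
                                                  linarith)).trans ?_
    rw [add_mul]
    gcongr
    rw [div_mul_eq_mul_div, div_le_iff₀ hp]
    nlinarith
  rw [← Real.sqrt_mul (norm_nonneg _)]
  exact Real.le_sqrt_of_sq_le k2

lemma IsSemiInner.triangle (H : IsSemiInner rs h) (x y : V) :
    √‖h (x + y) (x + y)‖ ≤ √‖h x x‖ + √‖h y y‖ := by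
  have a := Real.sq_sqrt (norm_nonneg (h x x))
  have b := Real.sq_sqrt (norm_nonneg (h y y))
  have c := H.norm_le x y
  have d := H.norm_le y x
  refine Real.sqrt_le_iff.mpr ⟨by positivity, ?_⟩
  calc ‖h (x + y) (x + y)‖ = ‖(h x x + h x y) + (h y x + h y y)‖ := by
        rw [H.add_left, map_add, map_add]
    _ ≤ (‖h x x‖ + ‖h x y‖) + (‖h y x‖ + ‖h y y‖) :=
        (norm_add_le _ _).trans (add_le_add (norm_add_le _ _) (norm_add_le _ _))
    _ ≤ _ := by nlinarith

end Semi

section C0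

variable {V : Type u} (A : V → Type u) [∀ v, NonUnitalCStarAlgebra (A v)]

/-- The `c₀`-direct sum of a family of `C*`-algebras, inside the `ℓ^∞`-direct sum. -/
def c0Sub : NonUnitalStarSubalgebra ℂ (lp A ∞) where
  carrier := {f | Tendsto (fun v => ‖f v‖) cofinite (𝓝 0)}
  zero_mem' := by
    have : Tendsto (fun _ : V => (0 : ℝ)) cofinite (𝓝 0) := tendsto_const_nhds
    simpa using this
  add_mem' {f g} hf hg := by
    refine squeeze_zero (fun _ => norm_nonneg _) (fun v => ?_) (by simpa using Tendsto.add hf hg)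
    exact norm_add_le _ _
  mul_mem' {f g} hf hg := by
    refine squeeze_zero (fun _ => norm_nonneg _) (fun v => ?_) (by simpa using Tendsto.mul hf hg)
    exact norm_mul_le _ _
  smul_mem' c f hf := by
    have : Tendsto (fun v => ‖c‖ * ‖f v‖) cofinite (𝓝 0) := by simpa using Tendsto.const_mul ‖c‖ hf
    refine squeeze_zero (fun _ => norm_nonneg _) (fun v => ?_) this
    simp [norm_smul]
  star_mem' {f} hf := by
    simpa using hf

/-- The `C*`-algebra `⨁ᵥ Aᵥ` (`c₀`-direct sum). -/
def C0Sum : Type u := c0Sub A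

instance c0Sub_isClosed : IsClosed (c0Sub A : Set (lp A ∞)) := by
  refine isClosed_of_closure_subset fun f hf => ?_
  rw [Metric.mem_closure_iff] at hf
  refine Metric.tendsto_nhds.mpr fun ε hε => ?_
  obtain ⟨g, hg, hfg⟩ := hf (ε / 2) (by positivity)
  filter_upwards [Metric.tendsto_nhds.mp hg (ε / 2) (by positivity)] with v hv
  have h1 : ‖(f - g) v‖ ≤ ‖f - g‖ := lp.norm_apply_le_norm ENNReal.top_ne_zero _ _
  rw [dist_eq_norm] at hfg
  simp only [dist_zero_right, norm_norm] at hv ⊢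
  have h2 : ‖f v‖ ≤ ‖(f - g) v‖ + ‖g v‖ := by
    have : f v = (f - g) v + g v := by simp
    rw [this]; exact norm_add_le _ _
  linarith

instance : NonUnitalCStarAlgebra (C0Sum A) :=
  NonUnitalStarSubalgebra.nonUnitalCStarAlgebra (c0Sub A)

variable {A}

/-- The `v`-component of an element of `⨁ᵥ Aᵥ`. -/
def C0Sum.eval (v : V) : C0Sum A →⋆ₙₐ[ℂ] A v where
  toFun a := a.1 v
  map_smul' _ _ := rfl
  map_zero' := rfl
  map_add' _ _ := rfl
  map_mul' _ _ := rfl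
  map_star' _ := rfl

@[ext] lemma C0Sum.ext {a b : C0Sum A} (h : ∀ v, C0Sum.eval v a = C0Sum.eval v b) : a = b :=
  Subtype.ext (lp.ext (funext h))

open Classical in
/-- The inclusion `Aᵥ → ⨁ᵥ Aᵥ`. -/
def C0Sum.single (v : V) : A v →⋆ₙₐ[ℂ] C0Sum A where
  toFun a := ⟨lp.single ∞ v a, by
    refine tendsto_const_nhds.congr' (f₁ := fun _ => (0 : ℝ)) ?_
    filter_upwards [(Set.finite_singleton v).compl_mem_cofinite] with w hw
    rw [lp.single_apply_ne _ _ _ (by simpa using hw), norm_zero]⟩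
  map_smul' c a := Subtype.ext (lp.single_smul ∞ v c a)
  map_zero' := Subtype.ext (lp.single_zero ∞ v)
  map_add' a b := Subtype.ext (lp.single_add ∞ v a b)
  map_mul' a b := by
    refine Subtype.ext (lp.ext (funext fun w => ?_))
    change (lp.single ∞ v (a * b) : lp A ∞) w = lp.single ∞ v a w * lp.single ∞ v b w
    by_cases hw : w = v
    · subst hw; simp
    · simp [hw]
  map_star' a := by
    refine Subtype.ext (lp.ext (funext fun w => ?_))
    change (lp.single ∞ v (star a) : lp A ∞) w = star (lp.single ∞ v a w)
    by_cases hw : w = v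
    · subst hw; simp
    · simp [hw]

lemma C0Sum.eval_single_same (v : V) (a : A v) : C0Sum.eval v (C0Sum.single v a) = a := by
  classical
  exact lp.single_apply_self (E := A) ∞ v a

lemma C0Sum.eval_single_ne {v w : V} (h : w ≠ v) (a : A v) :
    C0Sum.eval w (C0Sum.single v a) = 0 := by
  classical
  exact lp.single_apply_ne (E := A) ∞ v a h

lemma C0Sum.single_mul (v : V) (a : A v) (b : C0Sum A) :
    C0Sum.single v a * b = C0Sum.single v (a * C0Sum.eval v b) := by
  ext w
  rw [map_mul]
  by_cases hw : w = v
  · subst hw; simp [C0Sum.eval_single_same]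
  · simp [C0Sum.eval_single_ne hw]

lemma C0Sum.norm_single (v : V) (a : A v) : ‖C0Sum.single v a‖ = ‖a‖ := by
  classical
  exact lp.norm_single (E := A) ENNReal.zero_lt_top v a

/-- `C0Sum.eval` as a linear map. -/
def C0Sum.evalₗ (v : V) : C0Sum A →ₗ[ℂ] A v where
  toFun := C0Sum.eval v
  map_add' := map_add _
  map_smul' := map_smul _

/-- `C0Sum.single` as a linear map. -/
def C0Sum.singleₗ (v : V) : A v →ₗ[ℂ] C0Sum A where
  toFun := C0Sum.single v
  map_add' := map_add _
  map_smul' := map_smul _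

@[simp] lemma C0Sum.evalₗ_apply (v : V) (a : C0Sum A) : C0Sum.evalₗ v a = C0Sum.eval v a := rfl

@[simp] lemma C0Sum.singleₗ_apply (v : V) (a : A v) : C0Sum.singleₗ v a = C0Sum.single v a := rfl

/-- An `A_v`-`A_w` correspondence regarded as a correspondence over `⨁ᵥ Aᵥ`. -/
def Corr.inflate {v w : V} (E : Corr (A v) (A w)) : Corr (C0Sum A) (C0Sum A) where
  carrier := E
  rsmul := E.rsmul.compl₂ (C0Sum.evalₗ w)
  rsmul_mul x b c := by simp [E.rsmul_mul]
  inner x := C0Sum.singleₗ w ∘ₗ E.inner x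
  inner_rsmul x y b := by
    simp only [LinearMap.coe_comp, Function.comp_apply, LinearMap.compl₂_apply,
      C0Sum.singleₗ_apply, C0Sum.evalₗ_apply, E.inner_rsmul, C0Sum.single_mul]
  star_inner x y := by simp [← map_star, E.star_inner]
  inner_self_pos x := by
    obtain ⟨b, hb⟩ := E.inner_self_pos x
    exact ⟨C0Sum.single w b, by simp [hb, ← map_star]⟩
  norm_sq x := by
    rw [E.norm_sq]; exact (C0Sum.norm_single w _).symm
  φ := E.φ ∘ₗ C0Sum.evalₗ v
  φ_mul a b x := by simp [E.φ_mul]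
  inner_φ a x y := by
    simp only [LinearMap.coe_comp, Function.comp_apply, C0Sum.singleₗ_apply, C0Sum.evalₗ_apply,
      E.inner_φ, map_star]

end C0

namespace Corr

section Lemmas

attribute [local instance] CStarAlgebra.spectralOrder CStarAlgebra.spectralOrderedRing

variable {A B : Type u} [NonUnitalCStarAlgebra A] [NonUnitalCStarAlgebra B] (E : Corr A B)

lemma isSemiInner : IsSemiInner (fun x b => E.rsmul x b) E.inner :=
  ⟨E.inner_rsmul, E.star_inner, E.inner_self_pos⟩

lemma norm_eq (x : E) : ‖x‖ = √‖E.inner x x‖ := by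
  rw [← E.norm_sq, Real.sqrt_sq (norm_nonneg _)]

lemma inner_φ_self_le (a : A) (x : E) :
    E.inner (E.φ a x) (E.φ a x) ≤ (‖a‖ ^ 2) • E.inner x x := by
  have h0 := CStarAlgebra.star_mul_le_algebraMap_norm_sq (a := (a : Unitization ℂ A))
  rw [← sub_nonneg, CStarAlgebra.nonneg_iff_eq_star_mul_self] at h0
  obtain ⟨c, hc⟩ := h0
  have h1 := congrArg (fun z => z.fst) hc
  have h2 := congrArg (fun z => z.snd) hc
  rw [Unitization.norm_inr, IsScalarTower.algebraMap_apply ℝ ℂ (Unitization ℂ A)] at h1 h2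
  simp only [Unitization.algebraMap_eq_inl, sub_eq_add_neg, Unitization.fst_add, Unitization.fst_neg,
    Unitization.fst_mul,
    Unitization.fst_star, Unitization.fst_inr, Unitization.snd_add, Unitization.snd_neg, Unitization.snd_mul,
    Unitization.snd_star, Unitization.snd_inr, Unitization.fst_inl, Unitization.snd_inl,
    Complex.coe_algebraMap, star_zero, zero_smul, zero_add, mul_zero, neg_zero,
    add_zero] at h1 h2
  rw [← sub_nonneg]
  have e : (‖a‖ ^ 2) • E.inner x x - E.inner (E.φ a x) (E.φ a x)
      = E.inner (c.fst • x + E.φ c.snd x) (c.fst • x + E.φ c.snd x) := by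
    have e1 : (‖a‖ ^ 2) • E.inner x x = (star c.fst * c.fst) • E.inner x x := by
      rw [← h1, Complex.coe_smul]
    have e2 : E.inner (E.φ a x) (E.φ a x) = - E.inner x (E.φ (-(star a * a)) x) := by
      rw [E.inner_φ, ← E.φ_mul, map_neg, LinearMap.neg_apply, map_neg, neg_neg]
    rw [e1, e2, sub_neg_eq_add, h2, E.isSemiInner.add_left, E.isSemiInner.smul_left, E.inner_φ]
    simp only [map_add, map_smul, LinearMap.add_apply, LinearMap.smul_apply, E.φ_mul, smul_add,
      smul_smul]
    abel
  rw [e]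
  exact E.isSemiInner.nonneg _

end Lemmas

section L2

attribute [local instance] CStarAlgebra.spectralOrder CStarAlgebra.spectralOrderedRing

variable {A B : Type u} [NonUnitalCStarAlgebra A] [NonUnitalCStarAlgebra B]
  {I : Type u} (E : I → Corr A B)

/-- The partial inner product `∑_{i ∈ G} ⟨x i, y i⟩`. -/
def partialInner (G : Finset I) (x : ∀ i, E i) : (∀ i, E i) →ₗ[ℂ] B :=
  ∑ i ∈ G, (E i).inner (x i) ∘ₗ LinearMap.proj i

lemma partialInner_apply (G : Finset I) (x y : ∀ i, E i) :
    partialInner E G x y = ∑ i ∈ G, (E i).inner (x i) (y i) := by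
  simp [partialInner]

lemma partialInner_isSemiInner (G : Finset I) :
    IsSemiInner (fun (x : ∀ i, E i) (b : B) i => (E i).rsmul (x i) b) (partialInner E G) where
  rsmul x y b := by simp [partialInner_apply, (E _).inner_rsmul, Finset.sum_mul]
  symm x y := by simp [partialInner_apply, (E _).star_inner]
  pos x := by
    rw [← CStarAlgebra.nonneg_iff_eq_star_mul_self, partialInner_apply]
    exact Finset.sum_nonneg fun i _ => (E i).isSemiInner.nonneg _

/-- The seminorm `‖∑_{i ∈ G} ⟨x i, x i⟩‖^{1/2}`. -/
def partialNorm (G : Finset I) (x : ∀ i, E i) : ℝ := √‖partialInner E G x x‖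

lemma partialNorm_add (G : Finset I) (x y : ∀ i, E i) :
    partialNorm E G (x + y) ≤ partialNorm E G x + partialNorm E G y :=
  (partialInner_isSemiInner E G).triangle x y

lemma partialNorm_smul (G : Finset I) (c : ℂ) (x : ∀ i, E i) :
    partialNorm E G (c • x) = ‖c‖ * partialNorm E G x := by
  rw [partialNorm, (partialInner_isSemiInner E G).smul_left, map_smul, smul_smul, norm_smul,
    norm_mul, norm_star, Real.sqrt_mul (by positivity), Real.sqrt_mul_self (norm_nonneg _),
    partialNorm]

lemma partialNorm_le_sum (G : Finset I) (x : ∀ i, E i) :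
    partialNorm E G x ≤ ∑ i ∈ G, ‖x i‖ := by
  have h0 : 0 ≤ ∑ i ∈ G, ‖x i‖ := Finset.sum_nonneg fun i _ => norm_nonneg _
  refine Real.sqrt_le_iff.mpr ⟨h0, ?_⟩
  rw [partialInner_apply]
  refine (norm_sum_le _ _).trans ?_
  simp_rw [← (E _).norm_sq, pow_two, Finset.sum_mul]
  refine Finset.sum_le_sum fun i hi => ?_
  gcongr
  exact Finset.single_le_sum (f := fun i => ‖x i‖) (fun i _ => norm_nonneg _) hi

lemma partialNorm_φ_le (G : Finset I) (a : A) (x : ∀ i, E i) :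
    partialNorm E G (fun i => (E i).φ a (x i)) ≤ ‖a‖ * partialNorm E G x := by
  have h : partialInner E G (fun i => (E i).φ a (x i)) (fun i => (E i).φ a (x i))
      ≤ (‖a‖ ^ 2) • partialInner E G x x := by
    rw [partialInner_apply, partialInner_apply, Finset.smul_sum]
    exact Finset.sum_le_sum fun i _ => (E i).inner_φ_self_le a (x i)
  have h2 := CStarAlgebra.norm_le_norm_of_nonneg_of_le
    ((partialInner_isSemiInner E G).nonneg _) h
  rw [norm_smul, Real.norm_of_nonneg (by positivity)] at h2
  refine (Real.sqrt_le_sqrt h2).trans ?_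
  rw [Real.sqrt_mul (by positivity), Real.sqrt_sq (norm_nonneg _), partialNorm]

lemma partialNorm_rsmul_le (G : Finset I) (b : B) (x : ∀ i, E i) :
    partialNorm E G (fun i => (E i).rsmul (x i) b) ≤ ‖b‖ * partialNorm E G x := by
  have h : partialInner E G (fun i => (E i).rsmul (x i) b) (fun i => (E i).rsmul (x i) b)
      = star b * (partialInner E G x x * b) := by
    rw [(partialInner_isSemiInner E G).rsmul_left, (partialInner_isSemiInner E G).rsmul]
  refine Real.sqrt_le_iff.mpr ⟨by unfold partialNorm; positivity, ?_⟩
  rw [h, mul_pow, partialNorm, Real.sq_sqrt (norm_nonneg _)]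
  refine (norm_mul_le _ _).trans ?_
  rw [norm_star, pow_two, mul_assoc]
  gcongr
  rw [mul_comm ‖b‖]
  exact norm_mul_le _ _

lemma summable_iff_partialNorm (x : ∀ i, E i) :
    (Summable fun i => (E i).inner (x i) (x i)) ↔
      ∀ ε > 0, ∃ F : Finset I, ∀ G, Disjoint G F → partialNorm E G x < ε := by
  rw [summable_iff_vanishing_norm]
  constructor
  · intro h ε hε
    obtain ⟨F, hF⟩ := h (ε ^ 2) (by positivity)
    refine ⟨F, fun G hG => ?_⟩
    rw [partialNorm, Real.sqrt_lt' hε, partialInner_apply]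
    exact hF G hG
  · intro h ε hε
    obtain ⟨F, hF⟩ := h (√ε) (by positivity)
    refine ⟨F, fun G hG => ?_⟩
    have := hF G hG
    rw [partialNorm, Real.sqrt_lt_sqrt_iff (norm_nonneg _), partialInner_apply] at this
    exact this

/-- The families `(x i)` for which `∑ i, ⟨x i, x i⟩` converges in norm in `B`. -/
def l2Sub : Submodule ℂ (∀ i, E i) where
  carrier := {x | Summable fun i => (E i).inner (x i) (x i)}
  zero_mem' := by simp
  add_mem' {x y} hx hy := by
    classical
    rw [Set.mem_ofPred_eq, summable_iff_partialNorm] at *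
    intro ε hε
    obtain ⟨F, hF⟩ := hx (ε / 2) (by positivity)
    obtain ⟨F', hF'⟩ := hy (ε / 2) (by positivity)
    refine ⟨F ∪ F', fun G hG => ?_⟩
    rw [Finset.disjoint_union_right] at hG
    linarith [partialNorm_add E G x y, hF G hG.1, hF' G hG.2]
  smul_mem' c x hx := by
    rw [Set.mem_ofPred_eq, summable_iff_partialNorm] at *
    intro ε hε
    obtain ⟨F, hF⟩ := hx (ε / (‖c‖ + 1)) (by positivity)
    refine ⟨F, fun G hG => ?_⟩
    rw [partialNorm_smul]
    have h := hF G hG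
    rw [lt_div_iff₀ (by positivity)] at h
    have : 0 ≤ partialNorm E G x := Real.sqrt_nonneg _
    nlinarith

/-- The underlying space of the `ℓ²`-direct sum of the correspondences `E i`. -/
def L2Sum : Type u := l2Sub E

namespace L2Sum

instance : AddCommGroup (L2Sum E) := inferInstanceAs (AddCommGroup (l2Sub E))
instance : Module ℂ (L2Sum E) := inferInstanceAs (Module ℂ (l2Sub E))
instance : CoeFun (L2Sum E) (fun _ => ∀ i, E i) := ⟨fun x => x.1⟩

variable {E}

@[ext] lemma ext {x y : L2Sum E} (h : ∀ i, x i = y i) : x = y := Subtype.ext (funext h)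

@[simp] lemma add_apply (x y : L2Sum E) (i : I) : (x + y) i = x i + y i := rfl
@[simp] lemma sub_apply (x y : L2Sum E) (i : I) : (x - y) i = x i - y i := rfl
@[simp] lemma smul_apply (c : ℂ) (x : L2Sum E) (i : I) : (c • x) i = c • x i := rfl
@[simp] lemma zero_apply (i : I) : (0 : L2Sum E) i = 0 := rfl

lemma summable_inner (x y : L2Sum E) : Summable fun i => (E i).inner (x i) (y i) := by
  classical
  rw [summable_iff_vanishing_norm]
  intro ε hε
  obtain ⟨F, hF⟩ := (summable_iff_partialNorm E x).mp x.2 (√ε) (by positivity)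
  obtain ⟨F', hF'⟩ := (summable_iff_partialNorm E y).mp y.2 (√ε) (by positivity)
  refine ⟨F ∪ F', fun G hG => ?_⟩
  rw [Finset.disjoint_union_right] at hG
  rw [← partialInner_apply]
  have h1 := hF G hG.1
  have h2 := hF' G hG.2
  calc _ ≤ partialNorm E G x * partialNorm E G y := (partialInner_isSemiInner E G).norm_le _ _
    _ < √ε * √ε := mul_lt_mul'' h1 h2 (Real.sqrt_nonneg _) (Real.sqrt_nonneg _)
    _ = ε := Real.mul_self_sqrt hε.le

/-- The inner product `⟨x, y⟩ = ∑ i, ⟨x i, y i⟩`. -/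
def inner (x : L2Sum E) : L2Sum E →ₗ[ℂ] B where
  toFun y := ∑' i, (E i).inner (x i) (y i)
  map_add' y z := by
    simp only [add_apply, map_add]
    exact (summable_inner x y).tsum_add (summable_inner x z)
  map_smul' c y := by
    simp only [smul_apply, map_smul, RingHom.id_apply]
    exact (summable_inner x y).tsum_const_smul c

lemma hasSum_inner (x y : L2Sum E) : HasSum (fun i => (E i).inner (x i) (y i)) (inner x y) :=
  (summable_inner x y).hasSum

/-- The right action, componentwise. -/
def rsmul : L2Sum E →ₗ[ℂ] B →ₗ[ℂ] L2Sum E :=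
  LinearMap.mk₂ ℂ (fun x b => ⟨fun i => (E i).rsmul (x i) b, by
      change Summable _
      rw [summable_iff_partialNorm]
      intro ε hε
      obtain ⟨F, hF⟩ := (summable_iff_partialNorm E x).mp x.2 (ε / (‖b‖ + 1)) (by positivity)
      refine ⟨F, fun G hG => (partialNorm_rsmul_le E G b x).trans_lt ?_⟩
      have h := hF G hG
      rw [lt_div_iff₀ (by positivity)] at h
      have : 0 ≤ partialNorm E G x := Real.sqrt_nonneg _
      nlinarith⟩)
    (fun x y b => by ext i; simp; rfl) (fun c x b => by ext i; simp; rfl)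
    (fun x b c => by ext i; simp; rfl) (fun c x b => by ext i; simp; rfl)

/-- The left action, componentwise. -/
def φ : A →ₗ[ℂ] L2Sum E →ₗ[ℂ] L2Sum E :=
  LinearMap.mk₂ ℂ (fun a x => ⟨fun i => (E i).φ a (x i), by
      change Summable _
      rw [summable_iff_partialNorm]
      intro ε hε
      obtain ⟨F, hF⟩ := (summable_iff_partialNorm E x).mp x.2 (ε / (‖a‖ + 1)) (by positivity)
      refine ⟨F, fun G hG => (partialNorm_φ_le E G a x).trans_lt ?_⟩
      have h := hF G hG
      rw [lt_div_iff₀ (by positivity)] at h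
      have : 0 ≤ partialNorm E G x := Real.sqrt_nonneg _
      nlinarith⟩)
    (fun x y b => by ext i; simp; rfl) (fun c x b => by ext i; simp; rfl)
    (fun x b c => by ext i; simp; rfl) (fun c x b => by ext i; simp; rfl)

@[simp] lemma rsmul_apply (x : L2Sum E) (b : B) (i : I) : rsmul x b i = (E i).rsmul (x i) b := rfl
@[simp] lemma φ_apply (a : A) (x : L2Sum E) (i : I) : φ a x i = (E i).φ a (x i) := rfl

lemma nonneg_of_hasSum {J : Type u} {f : J → B} {b : B} (h : HasSum f b) (hf : ∀ i, 0 ≤ f i) :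
    0 ≤ b :=
  CStarAlgebra.isClosed_nonneg.mem_of_tendsto h
    (Eventually.of_forall fun _ => Finset.sum_nonneg fun i _ => hf i)

lemma isSemiInner : IsSemiInner (fun (x : L2Sum E) (b : B) => rsmul x b) inner where
  rsmul x y b := by
    refine HasSum.unique (hasSum_inner x (rsmul y b)) ?_
    simpa only [rsmul_apply, (E _).inner_rsmul] using (hasSum_inner x y).mul_right b
  symm x y := by
    refine HasSum.unique ?_ (hasSum_inner y x)
    simpa only [(E _).star_inner] using (hasSum_inner x y).star
  pos x := by
    rw [← CStarAlgebra.nonneg_iff_eq_star_mul_self]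
    exact nonneg_of_hasSum (hasSum_inner x x) fun i => (E i).isSemiInner.nonneg _

instance : Norm (L2Sum E) := ⟨fun x => √‖inner x x‖⟩

lemma norm_def (x : L2Sum E) : ‖x‖ = √‖inner x x‖ := rfl

lemma tendsto_partialNorm (x : L2Sum E) :
    Tendsto (fun G => partialNorm E G x) atTop (𝓝 ‖x‖) := by
  have := (hasSum_inner x x).norm.sqrt
  refine this.congr fun G => ?_
  rw [partialNorm, partialInner_apply]

lemma sum_le_inner (x : L2Sum E) (G : Finset I) :
    partialInner E G x x ≤ inner x x := by
  rw [← sub_nonneg]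
  refine CStarAlgebra.isClosed_nonneg.mem_of_tendsto
    (Tendsto.sub (hasSum_inner x x) tendsto_const_nhds) ?_
  filter_upwards [eventually_ge_atTop G] with G' hG'
  rw [sub_nonneg, partialInner_apply]
  exact Finset.sum_le_sum_of_subset_of_nonneg hG' fun i _ _ => (E i).isSemiInner.nonneg _

lemma partialNorm_le (x : L2Sum E) (G : Finset I) : partialNorm E G x ≤ ‖x‖ :=
  Real.sqrt_le_sqrt (CStarAlgebra.norm_le_norm_of_nonneg_of_le
    ((partialInner_isSemiInner E G).nonneg _) (sum_le_inner x G))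

lemma norm_apply_le (x : L2Sum E) (i : I) : ‖x i‖ ≤ ‖x‖ := by
  refine le_trans (le_of_eq ?_) (partialNorm_le x {i})
  rw [partialNorm, partialInner_apply, Finset.sum_singleton, ← (E i).norm_eq]

lemma core : NormedSpace.Core ℂ (L2Sum E) where
  norm_nonneg x := Real.sqrt_nonneg _
  norm_smul c x := by
    rw [norm_def, isSemiInner.smul_left, map_smul, smul_smul, norm_smul,
      norm_mul, norm_star, Real.sqrt_mul (by positivity), Real.sqrt_mul_self (norm_nonneg _),
      norm_def]
  norm_triangle x y := isSemiInner.triangle x y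
  norm_eq_zero_iff x := by
    constructor
    · intro h
      ext i
      have := norm_apply_le x i
      rw [h] at this
      simpa using this
    · rintro rfl
      simp [norm_def]

instance : NormedAddCommGroup (L2Sum E) := NormedAddCommGroup.ofCore core
instance : NormedSpace ℂ (L2Sum E) := NormedSpace.ofCore core

instance : CompleteSpace (L2Sum E) := by
  refine Metric.complete_of_cauchySeq_tendsto fun s hs => ?_
  have hc : ∀ i, CauchySeq fun n => s n i := by
    intro i
    rw [Metric.cauchySeq_iff'] at hs ⊢
    intro ε hε
    obtain ⟨N, hN⟩ := hs ε hε
    refine ⟨N, fun n hn => lt_of_le_of_lt ?_ (hN n hn)⟩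
    rw [dist_eq_norm, dist_eq_norm]
    exact norm_apply_le (s n - s N) i
  choose y hy using fun i => cauchySeq_tendsto_of_complete (hc i)
  have hest : ∀ ε > 0, ∃ N, ∀ n ≥ N, ∀ G, partialNorm E G ((s n : ∀ i, E i) - y) ≤ ε := by
    intro ε hε
    obtain ⟨N, hN⟩ := Metric.cauchySeq_iff.mp hs ε hε
    refine ⟨N, fun n hn G => ?_⟩
    have hlim : Tendsto (fun m => ε + ∑ i ∈ G, ‖s m i - y i‖) atTop (𝓝 (ε + ∑ _i ∈ G, 0)) := by
      refine tendsto_const_nhds.add (tendsto_finsetSum _ fun i _ => ?_)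
      exact tendsto_iff_norm_sub_tendsto_zero.mp (hy i)
    rw [Finset.sum_const_zero, add_zero] at hlim
    refine ge_of_tendsto hlim ?_
    filter_upwards [eventually_ge_atTop N] with m hm
    have e : ((s n : ∀ i, E i) - y) = ((s n - s m : L2Sum E) : ∀ i, E i) + (fun i => s m i - y i) := by
      funext i; simp
    rw [e]
    refine (partialNorm_add E G _ _).trans (add_le_add ?_ (partialNorm_le_sum E G _))
    refine (partialNorm_le _ G).trans ?_
    rw [← dist_eq_norm]
    exact (hN n hn m hm).le
  have hmem : y ∈ l2Sub E := by
    change Summable _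
    rw [summable_iff_partialNorm]
    intro ε hε
    obtain ⟨N, hN⟩ := hest (ε / 2) (by positivity)
    obtain ⟨F, hF⟩ := (summable_iff_partialNorm E (s N)).mp (s N).2 (ε / 2) (by positivity)
    refine ⟨F, fun G hG => ?_⟩
    have e : y = (s N : ∀ i, E i) + (-1 : ℂ) • ((s N : ∀ i, E i) - y) := by
      funext i; simp
    rw [e]
    have h1 := partialNorm_add E G (s N : ∀ i, E i) ((-1 : ℂ) • ((s N : ∀ i, E i) - y))
    rw [partialNorm_smul, norm_neg, norm_one, one_mul] at h1
    linarith [hN N le_rfl G, hF G hG]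
  let z : L2Sum E := ⟨y, hmem⟩
  refine ⟨z, Metric.tendsto_atTop.mpr fun ε hε => ?_⟩
  obtain ⟨N, hN⟩ := hest (ε / 2) (by positivity)
  refine ⟨N, fun n hn => ?_⟩
  rw [dist_eq_norm]
  refine lt_of_le_of_lt (le_of_tendsto (tendsto_partialNorm _) ?_) (half_lt_self hε)
  exact Eventually.of_forall fun G => hN n hn G

open Classical in
/-- The inclusion of the `i`-th summand. -/
def single (i : I) : E i →ₗ[ℂ] L2Sum E where
  toFun x := ⟨Pi.single i x, by
    refine summable_of_ne_finset_zero (s := {i}) fun j hj => ?_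
    rw [Pi.single_eq_of_ne (by simpa using hj), map_zero]⟩
  map_add' x y := Subtype.ext (Pi.single_add (f := fun i => (E i).carrier) i x y)
  map_smul' c x := Subtype.ext (Pi.single_smul (f := fun i => (E i).carrier) i c x)

@[simp] lemma single_same (i : I) (x : E i) : single i x i = x := by
  classical
  exact Pi.single_eq_same (M := fun i => (E i).carrier) i x

lemma single_ne {i j : I} (h : j ≠ i) (x : E i) : single i x j = 0 := by
  classical
  exact Pi.single_eq_of_ne (M := fun i => (E i).carrier) h x

lemma norm_single (i : I) (x : E i) : ‖single i x‖ = ‖x‖ := by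
  rw [norm_def, (E i).norm_eq]
  congr 2
  refine HasSum.unique (hasSum_inner _ _) ?_
  have := hasSum_single (f := fun j => (E j).inner (single i x j) (single i x j)) i
    (fun j hj => by rw [single_ne hj, map_zero])
  simpa using this

lemma sum_single_apply (G : Finset I) (y : ∀ i, E i) (j : I) [Decidable (j ∈ G)] :
    (∑ i ∈ G, single i (y i)) j = if j ∈ G then y j else 0 := by
  classical
  have h : ∀ G : Finset I, (∑ i ∈ G, single i (y i)) j = ∑ i ∈ G, single i (y i) j := by
    intro G
    induction G using Finset.induction_on with
    | empty => simp
    | insert a s ha ih => rw [Finset.sum_insert ha, Finset.sum_insert ha, add_apply, ih]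
  rw [h]
  split_ifs with hj
  · rw [Finset.sum_eq_single j (fun i _ hi => single_ne hi.symm _) (fun h => absurd hj h),
      single_same]
  · refine Finset.sum_eq_zero fun i hi => single_ne ?_ _
    rintro rfl
    exact hj hi

lemma hasSum_single_apply (y : L2Sum E) : HasSum (fun i => single i (y i)) y := by
  classical
  refine Metric.tendsto_atTop.mpr fun ε hε => ?_
  obtain ⟨F, hF⟩ := (summable_iff_partialNorm E y).mp y.2 (ε / 2) (by positivity)
  refine ⟨F, fun G hG => ?_⟩
  rw [dist_comm, dist_eq_norm]
  refine lt_of_le_of_lt (le_of_tendsto (tendsto_partialNorm _) ?_) (half_lt_self hε)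
  refine Eventually.of_forall fun G' => le_trans (le_of_eq ?_)
    (hF (G' \ G) (Finset.disjoint_of_subset_right hG Finset.sdiff_disjoint)).le
  rw [partialNorm, partialNorm]
  congr 2
  rw [partialInner_apply, partialInner_apply, Finset.sdiff_eq_filter, Finset.sum_filter]
  refine Finset.sum_congr rfl fun j _ => ?_
  rw [sub_apply, sum_single_apply]
  split_ifs <;> simp_all

/-- A submodule whose closure contains every summand is dense. -/
lemma dense_of_single (S : Submodule ℂ (L2Sum E))
    (h : ∀ i x, single i x ∈ closure (S : Set (L2Sum E))) : Dense (S : Set (L2Sum E)) := by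
  intro y
  rw [← S.topologicalClosure_coe] at h ⊢
  exact S.isClosed_topologicalClosure.mem_of_tendsto (hasSum_single_apply y)
    (Eventually.of_forall fun G => S.topologicalClosure.sum_mem fun i _ => h i _)

end L2Sum

/-- The `ℓ²`-direct sum of a family of correspondences from `A` to `B`. -/
def l2Sum : Corr A B where
  carrier := L2Sum E
  rsmul := L2Sum.rsmul
  rsmul_mul x b c := by
    ext i
    exact (E i).rsmul_mul _ _ _
  inner := L2Sum.inner
  inner_rsmul := L2Sum.isSemiInner.rsmul
  star_inner := L2Sum.isSemiInner.symm
  inner_self_pos := L2Sum.isSemiInner.pos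
  norm_sq x := by
    rw [L2Sum.norm_def, Real.sq_sqrt (norm_nonneg _)]
  φ := L2Sum.φ
  φ_mul a b x := by
    ext i
    exact (E i).φ_mul _ _ _
  inner_φ a x y := by
    refine HasSum.unique (L2Sum.hasSum_inner _ _) ?_
    simpa only [L2Sum.φ_apply, (E _).inner_φ] using L2Sum.hasSum_inner x (L2Sum.φ (star a) y)

end L2

section Tensor

attribute [local instance] CStarAlgebra.spectralOrder CStarAlgebra.spectralOrderedRing

variable {A B C : Type u} [NonUnitalCStarAlgebra A] [NonUnitalCStarAlgebra B]
  [NonUnitalCStarAlgebra C]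

lemma inner_φ_mono (F : Corr B C) (y : F) {b b' : B} (h : b ≤ b') :
    F.inner y (F.φ b y) ≤ F.inner y (F.φ b' y) := by
  rw [← sub_nonneg] at h ⊢
  obtain ⟨c, hc⟩ := CStarAlgebra.nonneg_iff_eq_star_mul_self.mp h
  have : F.inner y (F.φ b' y) - F.inner y (F.φ b y) = F.inner (F.φ c y) (F.φ c y) := by
    rw [F.inner_φ, ← F.φ_mul, ← hc, map_sub, LinearMap.sub_apply, map_sub]
  rw [this]
  exact F.isSemiInner.nonneg _

lemma norm_φ_le (F : Corr B C) (b : B) (y : F) : ‖F.φ b y‖ ≤ ‖b‖ * ‖y‖ := by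
  have h := CStarAlgebra.norm_le_norm_of_nonneg_of_le
    (F.isSemiInner.nonneg _) (F.inner_φ_self_le b y)
  rw [norm_smul, ← F.norm_sq, ← F.norm_sq, Real.norm_of_nonneg (by positivity), ← mul_pow] at h
  exact le_of_sq_le_sq h (by positivity)

lemma tendsto_inner_φ (F : Corr B C) (y : F) {J : Type u} {l : Filter J} {s : J → B} {b : B}
    (h : Tendsto s l (𝓝 b)) :
    Tendsto (fun j => F.inner y (F.φ (s j) y)) l (𝓝 (F.inner y (F.φ b y))) := by
  rw [tendsto_iff_norm_sub_tendsto_zero] at h ⊢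
  have h2 : Tendsto (fun j => ‖y‖ * (‖s j - b‖ * ‖y‖)) l (𝓝 0) := by
    simpa using (h.mul_const ‖y‖).const_mul ‖y‖
  refine squeeze_zero (fun _ => norm_nonneg _) (fun j => ?_) h2
  rw [← map_sub, ← LinearMap.sub_apply, ← map_sub]
  refine (F.isSemiInner.norm_le _ _).trans ?_
  rw [← F.norm_eq, ← F.norm_eq]
  gcongr
  exact F.norm_φ_le _ _

lemma hasSum_of_nonneg {J : Type u} {f : J → C} {L : C} (h0 : ∀ j, 0 ≤ f j)
    (hle : ∀ G : Finset J, ∑ j ∈ G, f j ≤ L)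
    (happ : ∀ ε > 0, ∃ G : Finset J, ‖L - ∑ j ∈ G, f j‖ < ε) : HasSum f L := by
  classical
  refine Metric.tendsto_atTop.mpr fun ε hε => ?_
  obtain ⟨G, hG⟩ := happ ε hε
  refine ⟨G, fun G' hG' => ?_⟩
  rw [dist_comm, dist_eq_norm]
  refine lt_of_le_of_lt (CStarAlgebra.norm_le_norm_of_nonneg_of_le (sub_nonneg.mpr (hle G')) ?_) hG
  exact sub_le_sub_left (Finset.sum_le_sum_of_subset_of_nonneg hG' fun i _ _ => h0 i) _

/-- The inner product of a (formal) elementary tensor of two elements of `ℓ²`-direct sums. -/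
lemma hasSum_tensor {I J : Type u} {E : I → Corr A B} {F : J → Corr B C}
    (x : L2Sum E) (y : L2Sum F) :
    HasSum (fun p : I × J => (F p.2).inner (y p.2) ((F p.2).φ ((E p.1).inner (x p.1) (x p.1))
      (y p.2))) (L2Sum.inner y (L2Sum.φ (L2Sum.inner x x) y)) := by
  classical
  set t : I × J → C := fun p => (F p.2).inner (y p.2) ((F p.2).φ ((E p.1).inner (x p.1) (x p.1))
      (y p.2)) with ht
  set S := L2Sum.inner x x
  have hpos : ∀ (j : J) (b : B), 0 ≤ b → 0 ≤ (F j).inner (y j) ((F j).φ b (y j)) := by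
    intro j b hb
    have := (F j).inner_φ_mono (y j) hb
    rwa [map_zero, LinearMap.zero_apply, map_zero] at this
  have ht0 : ∀ p, 0 ≤ t p := fun p => hpos _ _ ((E p.1).isSemiInner.nonneg _)
  have hprod : ∀ (P : Finset I) (Q : Finset J), ∑ p ∈ P ×ˢ Q, t p
      = ∑ j ∈ Q, (F j).inner (y j) ((F j).φ (partialInner E P x x) (y j)) := by
    intro P Q
    rw [Finset.sum_product_right]
    refine Finset.sum_congr rfl fun j _ => ?_
    simp [ht, partialInner_apply]
  have hS : 0 ≤ S := L2Sum.isSemiInner.nonneg x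
  have hL : HasSum (fun j => (F j).inner (y j) ((F j).φ S (y j))) (L2Sum.inner y (L2Sum.φ S y)) :=
    L2Sum.hasSum_inner y (L2Sum.φ S y)
  refine hasSum_of_nonneg ht0 (fun G => ?_) (fun ε hε => ?_)
  · calc ∑ p ∈ G, t p ≤ ∑ p ∈ (G.image Prod.fst) ×ˢ (G.image Prod.snd), t p :=
          Finset.sum_le_sum_of_subset_of_nonneg Finset.subset_product fun i _ _ => ht0 i
      _ = _ := hprod _ _
      _ ≤ ∑ j ∈ G.image Prod.snd, (F j).inner (y j) ((F j).φ S (y j)) :=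
          Finset.sum_le_sum fun j _ => (F j).inner_φ_mono _ (L2Sum.sum_le_inner x _)
      _ ≤ _ := by
          rw [← sub_nonneg]
          refine CStarAlgebra.isClosed_nonneg.mem_of_tendsto
            (Tendsto.sub hL tendsto_const_nhds) ?_
          filter_upwards [eventually_ge_atTop (G.image Prod.snd)] with G' hG'
          rw [sub_nonneg]
          exact Finset.sum_le_sum_of_subset_of_nonneg hG' fun i _ _ => hpos _ _ hS
  · obtain ⟨Q, hQ⟩ := (Metric.tendsto_atTop.mp hL) (ε / 2) (by positivity)
    have hQ := hQ Q le_rfl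
    have h1 : Tendsto (fun P => ∑ p ∈ P ×ˢ Q, t p) atTop
        (𝓝 (∑ j ∈ Q, (F j).inner (y j) ((F j).φ S (y j)))) := by
      simp_rw [hprod]
      refine tendsto_finsetSum _ fun j _ => (F j).tendsto_inner_φ (y j) ?_
      exact (L2Sum.hasSum_inner x x).congr fun P => (partialInner_apply E P x x).symm
    obtain ⟨P, hP⟩ := (Metric.tendsto_atTop.mp h1) (ε / 2) (by positivity)
    refine ⟨P ×ˢ Q, ?_⟩
    have hP := hP P le_rfl
    rw [← dist_eq_norm, dist_comm]
    linarith [dist_triangle (∑ p ∈ P ×ˢ Q, t p)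
      (∑ j ∈ Q, (F j).inner (y j) ((F j).φ S (y j))) (L2Sum.inner y (L2Sum.φ S y))]

/-- Polarisation: a sesquilinear map that vanishes on the diagonal is zero. -/
lemma polarisation {V W : Type u} [AddCommGroup V] [Module ℂ V] [AddCommGroup W] [Module ℂ W]
    (D : V → V →ₗ[ℂ] W) (hadd : ∀ x y z, D (x + y) z = D x z + D y z)
    (hsmul : ∀ (c : ℂ) x z, D (c • x) z = star c • D x z) (h0 : ∀ x, D x x = 0) (x y : V) :
    D x y = 0 := by
  have h1 := h0 (x + y)
  rw [hadd, map_add, map_add, h0, h0, zero_add, add_zero] at h1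
  have h2 := h0 (x + Complex.I • y)
  rw [hadd, map_add, map_add, h0, hsmul, hsmul, map_smul, map_smul, h0, zero_add, smul_zero,
    smul_zero, add_zero] at h2
  have h3 : Complex.I • (D x y - D y x) = 0 := by
    rw [smul_sub, ← h2]
    simp [sub_eq_add_neg]
  rw [smul_eq_zero_iff_right Complex.I_ne_zero, sub_eq_zero] at h3
  rw [← h3, ← two_smul ℂ] at h1
  simpa using h1

end Tensor
end Corr

/-- An inner-product preserving map of correspondences `E ⊗_B F → G`, given by its values
`m x y` on elementary tensors `x ⊗ y`.

The internal tensor product `E ⊗_B F` is the Hausdorff completion of the algebraic tensor product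
for `⟨x ⊗ y, x' ⊗ y'⟩ = ⟨y, φ(⟨x, x'⟩) y'⟩`, with the actions `a · (x ⊗ y) = (a · x) ⊗ y` and
`(x ⊗ y) · c = x ⊗ (y · c)`; so a bilinear map `m` with the three properties below is the same
thing as a linear map `E ⊗_B F → G` that preserves inner products and both actions. (That `m` is
balanced over `B` follows from `inner_map`.) -/
structure Corr.IsTensorMap {A B C : Type u} [NonUnitalCStarAlgebra A] [NonUnitalCStarAlgebra B]
    [NonUnitalCStarAlgebra C] {E : Corr A B} {F : Corr B C} {G : Corr A C}
    (m : E →ₗ[ℂ] F →ₗ[ℂ] G) : Prop where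
  map_φ : ∀ a x y, m (E.φ a x) y = G.φ a (m x y)
  map_rsmul : ∀ x y c, m x (F.rsmul y c) = G.rsmul (m x y) c
  inner_map : ∀ x y x' y', G.inner (m x y) (m x' y') = F.inner y (F.φ (E.inner x x') y')

/-- The map `E ⊗_B F → G` with values `m x y` on elementary tensors is an isomorphism of
correspondences.  As it is isometric, it is surjective if and only if the linear span of the
elements `m x y` is dense. -/
structure Corr.IsTensorIso {A B C : Type u} [NonUnitalCStarAlgebra A] [NonUnitalCStarAlgebra B]
    [NonUnitalCStarAlgebra C] {E : Corr A B} {F : Corr B C} {G : Corr A C}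
    (m : E →ₗ[ℂ] F →ₗ[ℂ] G) : Prop extends Corr.IsTensorMap m where
  dense : Dense (Submodule.span ℂ {z : G | ∃ x y, z = m x y} : Set G)

/-- `j` is an isomorphism from the identity correspondence `A` (with `⟨a, b⟩ = a* b` and with
multiplication in `A` as left and right action) onto `E`. -/
structure Corr.IsIdentity {A : Type u} [NonUnitalCStarAlgebra A] (E : Corr A A)
    (j : A →ₗ[ℂ] E) : Prop where
  surjective : Function.Surjective j
  inner_map : ∀ a b, E.inner (j a) (j b) = star a * b
  φ_map : ∀ a b, E.φ a (j b) = j (a * b)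
  rsmul_map : ∀ a b, E.rsmul (j a) b = j (a * b)

/-- A product system over `P` of correspondences over `A`.  The semigroup is the disjoint union
`Σ p, Y p`.  The identity fibre is identified with the identity correspondence `A` through
`unit`. -/
structure ProductSystem (P : Type) [AddMonoid P] (A : Type u) [NonUnitalCStarAlgebra A] where
  Y : P → Corr A A
  mul : ∀ p q, Y p →ₗ[ℂ] Y q →ₗ[ℂ] Y (p + q)
  mul_assoc : ∀ p q r (x : Y p) (y : Y q) (z : Y r),
    (⟨_, mul _ _ (mul _ _ x y) z⟩ : Σ p, Y p) = ⟨_, mul _ _ x (mul _ _ y z)⟩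
  unit : A →ₗ[ℂ] Y 0
  isIdentity : (Y 0).IsIdentity unit
  unit_mul : ∀ p a (x : Y p), (⟨_, mul _ _ (unit a) x⟩ : Σ p, Y p) = ⟨_, (Y p).φ a x⟩
  mul_unit : ∀ p (x : Y p) a, (⟨_, mul _ _ x (unit a)⟩ : Σ p, Y p) = ⟨_, (Y p).rsmul x a⟩
  isTensorIso : ∀ p q, p ≠ 0 → q ≠ 0 → Corr.IsTensorIso (mul p q)

/-- A representation `(t, π)` of a correspondence `E` over `A` in a `C*`-algebra `B`. -/
structure Corr.IsRep {A B : Type u} [NonUnitalCStarAlgebra A] [NonUnitalCStarAlgebra B]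
    (E : Corr A A) (t : E →ₗ[ℂ] B) (π : A →⋆ₙₐ[ℂ] B) : Prop where
  map_φ : ∀ a x, t (E.φ a x) = π a * t x
  map_rsmul : ∀ x a, t (E.rsmul x a) = t x * π a
  map_inner : ∀ x y, π (E.inner x y) = star (t x) * t y

/-- A representation of a product system in a `C*`-algebra `B`: maps `ψ p : Y p → B`, where
`ψe : A → B` is `ψ 0` under the identification of `Y 0` with `A`. -/
structure ProductSystem.Rep {P : Type} [AddMonoid P] {A : Type u} [NonUnitalCStarAlgebra A]
    (Y : ProductSystem P A) (B : Type u) [NonUnitalCStarAlgebra B] where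
  ψ : ∀ p, Y.Y p →ₗ[ℂ] B
  ψe : A →⋆ₙₐ[ℂ] B
  ψ_unit : ∀ a, ψ 0 (Y.unit a) = ψe a
  isRep : ∀ p, (Y.Y p).IsRep (ψ p) ψe
  map_mul : ∀ p q (x : Y.Y p) (y : Y.Y q), ψ (p + q) (Y.mul p q x y) = ψ p x * ψ q y

/-- `i : Y → T` is a universal (Toeplitz) representation, that is, `T` is the Toeplitz algebra
`𝒯_Y` with its canonical representation: `T` is generated by the image of `i`, and every
representation of `Y` factors through `i`. -/
structure ProductSystem.Rep.IsToeplitz {P : Type} [AddMonoid P] {A : Type u}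
    [NonUnitalCStarAlgebra A] {Y : ProductSystem P A} {T : Type u} [NonUnitalCStarAlgebra T]
    (i : Y.Rep T) : Prop where
  generates : Dense (NonUnitalStarAlgebra.adjoin ℂ {t : T | ∃ p y, t = i.ψ p y} : Set T)
  lift : ∀ (C : Type u) [NonUnitalCStarAlgebra C] (ψ : Y.Rep C),
    ∃ Φ : T →⋆ₙₐ[ℂ] C, ∀ p y, Φ (i.ψ p y) = ψ.ψ p y

/-- A `k`-graph structure on a small category `Λ`.  A morphism `f : u ⟶ v` is a path with source
`u` and range `v`; the composite of paths `αβ`, with `s(α) = r(β)`, is `β ≫ α`. -/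
structure KGraph (k : ℕ) (Λ : Type u) [SmallCategory Λ] where
  nonempty : Nonempty Λ
  countable : Countable (Σ u v : Λ, (u ⟶ v))
  /-- the degree functor -/
  d : ∀ {u v : Λ}, (u ⟶ v) → (Fin k → ℕ)
  d_id : ∀ v : Λ, d (𝟙 v) = 0
  d_comp : ∀ {u v w : Λ} (α : v ⟶ w) (β : u ⟶ v), d (β ≫ α) = d α + d β
  /-- the factorisation property -/
  factorisation : ∀ {u w : Λ} (f : u ⟶ w) (m n : Fin k → ℕ), d f = m + n →
    ∃! p : Σ v : Λ, (v ⟶ w) × (u ⟶ v),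
      d p.2.1 = m ∧ d p.2.2 = n ∧ p.2.2 ≫ p.2.1 = f

/-- The morphisms of `Λ`. -/
structure KPath (Λ : Type u) [SmallCategory Λ] where
  {src rng : Λ}
  hom : src ⟶ rng

namespace KGraph

variable {k : ℕ} {Λ : Type u} [SmallCategory Λ] (G : KGraph k Λ)

/-- The set `Λⁿ` of paths of degree `n`. -/
def PathOf (n : Fin k → ℕ) : Type u := {p : KPath Λ // G.d p.hom = n}

variable {G} in
/-- A path of degree `n` as an element of `Λⁿ`. -/
abbrev PathOf.mk {n : Fin k → ℕ} {u v : Λ} (f : u ⟶ v) (h : G.d f = n) : G.PathOf n := ⟨⟨f⟩, h⟩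

/-- `vΛⁿ` is finite and nonempty for all vertices `v` and all `n`. -/
def IsRowFiniteNoSources : Prop :=
  ∀ (v : Λ) (n : Fin k → ℕ), {p : KPath Λ | p.rng = v ∧ G.d p.hom = n}.Finite ∧
    {p : KPath Λ | p.rng = v ∧ G.d p.hom = n}.Nonempty

lemma eq_id {u v : Λ} (f : u ⟶ v) (h : G.d f = 0) : ∃ e : u = v, f = eqToHom e := by
  have h1 := (G.factorisation f 0 0 (by rw [h, add_zero])).unique
    (y₁ := ⟨v, 𝟙 v, f⟩) (y₂ := ⟨u, f, 𝟙 u⟩) ⟨G.d_id v, h, by simp⟩ ⟨h, G.d_id u, by simp⟩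
  obtain rfl : v = u := congrArg Sigma.fst h1
  refine ⟨rfl, ?_⟩
  simp only [Sigma.mk.injEq, heq_eq_eq, true_and, Prod.mk.injEq] at h1
  exact h1.2

end KGraph

/-- A `Λ`-system of `C*`-correspondences `(A, X, χ)`.

For a path `f` with source `v` and range `w`, `X f` is an `A_w`-`A_v` correspondence.  The
correspondence `X (𝟙 v)` is identified with the identity correspondence over `A_v` through
`unit v`.  The map `χ_{α,β} : X_α ⊗ X_β → X_{αβ}` is given by its values `χ α β x y` on elementary
tensors `x ⊗ y`.  (For `α` a vertex, `χ_left` determines `χ_{α,β}`, and the map so determined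
always preserves inner products.) -/
structure LambdaSystem {k : ℕ} {Λ : Type u} [SmallCategory Λ] (G : KGraph k Λ) where
  A : Λ → Type u
  [cstarAlgebra : ∀ v, NonUnitalCStarAlgebra (A v)]
  X : ∀ {v w : Λ}, (v ⟶ w) → Corr (A w) (A v)
  χ : ∀ {u v w : Λ} (α : v ⟶ w) (β : u ⟶ v), X α →ₗ[ℂ] X β →ₗ[ℂ] X (β ≫ α)
  χ_map : ∀ {u v w : Λ} (α : v ⟶ w) (β : u ⟶ v), Corr.IsTensorMap (χ α β)
  χ_iso : ∀ {u v w : Λ} (α : v ⟶ w) (β : u ⟶ v), G.d α ≠ 0 → Corr.IsTensorIso (χ α β)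
  unit : ∀ v, A v →ₗ[ℂ] X (𝟙 v)
  isIdentity : ∀ v, (X (𝟙 v)).IsIdentity (unit v)
  χ_left : ∀ {v w : Λ} (f : v ⟶ w) (a : A w) (x : X f),
    (⟨_, χ (𝟙 w) f (unit w a) x⟩ : Σ g : v ⟶ w, X g) = ⟨f, (X f).φ a x⟩
  χ_right : ∀ {v w : Λ} (f : v ⟶ w) (x : X f) (a : A v),
    (⟨_, χ f (𝟙 v) x (unit v a)⟩ : Σ g : v ⟶ w, X g) = ⟨f, (X f).rsmul x a⟩
  χ_assoc : ∀ {t u v w : Λ} (α : v ⟶ w) (β : u ⟶ v) (γ : t ⟶ u) (x : X α) (y : X β) (z : X γ),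
    (⟨_, χ _ _ (χ _ _ x y) z⟩ : Σ g : t ⟶ w, X g) = ⟨_, χ _ _ x (χ _ _ y z)⟩

attribute [instance] LambdaSystem.cstarAlgebra

namespace LambdaSystem

variable {k : ℕ} {Λ : Type u} [SmallCategory Λ] {G : KGraph k Λ} (X : LambdaSystem G)

/-- Regularity of a `Λ`-system. -/
structure IsRegular : Prop where
  rowFinite_noSources : G.IsRowFiniteNoSources
  nondegenerate : ∀ {v w : Λ} (f : v ⟶ w), (X.X f).IsNondegenerate
  full : ∀ {v w : Λ} (f : v ⟶ w), (X.X f).IsFull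
  injective : ∀ {v w : Λ} (f : v ⟶ w), Function.Injective (X.X f).φ
  compact : ∀ {v w : Λ} (f : v ⟶ w) (a : X.A w), (X.X f).IsCompactOp ((X.X f).φ a)

/-- A representation `(ρ, π)` of a `Λ`-system in a `C*`-algebra `B`. -/
structure Rep (B : Type u) [NonUnitalCStarAlgebra B] where
  ρ : ∀ {v w : Λ} (f : v ⟶ w), X.X f →ₗ[ℂ] B
  π : ∀ v, X.A v →⋆ₙₐ[ℂ] B
  ρ_vertex : ∀ v a, ρ (𝟙 v) (X.unit v a) = π v a
  ρ_mul : ∀ {u v w : Λ} (α : v ⟶ w) (β : u ⟶ v) (x : X.X α) (y : X.X β),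
    ρ α x * ρ β y = ρ (β ≫ α) (X.χ α β x y)
  ρ_mul_eq_zero : ∀ {u v v' w : Λ} (α : v ⟶ w) (β : u ⟶ v') (x : X.X α) (y : X.X β),
    v ≠ v' → ρ α x * ρ β y = 0
  ρ_star_mul : ∀ {v w : Λ} (α : v ⟶ w) (x y : X.X α),
    star (ρ α x) * ρ α y = π v ((X.X α).inner x y)
  ρ_star_mul_eq_zero : ∀ {v w v' w' : Λ} (α : v ⟶ w) (β : v' ⟶ w') (x : X.X α) (y : X.X β),
    G.d α = G.d β → (⟨α⟩ : KPath Λ) ≠ ⟨β⟩ → star (ρ α x) * ρ β y = 0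

/-- Universality of a representation of a `Λ`-system. -/
def Rep.IsUniversal {X : LambdaSystem G} {B : Type u} [NonUnitalCStarAlgebra B]
    (R : X.Rep B) : Prop :=
  ∀ (C : Type u) [NonUnitalCStarAlgebra C] (R' : X.Rep C),
    ∃! Φ : B →⋆ₙₐ[ℂ] C,
      (∀ {v w : Λ} (f : v ⟶ w) (x : X.X f), Φ (R.ρ f x) = R'.ρ f x) ∧
      (∀ v a, Φ (R.π v a) = R'.π v a)

/-- The `c₀`-direct sum `A = ⨁ᵥ Aᵥ`. -/
abbrev algA : Type u := C0Sum X.A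

/-- `X_λ` regarded as a correspondence over `A`, for `λ ∈ Λⁿ`. -/
abbrev summand (n : Fin k → ℕ) (l : G.PathOf n) : Corr X.algA X.algA := (X.X l.1.hom).inflate

/-- The fibre `Yₙ = ⨁_{λ ∈ Λⁿ} X_λ` (`ℓ²`-direct sum of correspondences over `A`). -/
def fibre (n : Fin k → ℕ) : Corr X.algA X.algA := Corr.l2Sum (X.summand n)

/-- The inclusion of the summand `X_f` in `Yₙ`, for a path `f` of degree `n`. -/
def incl {n : Fin k → ℕ} {v w : Λ} (f : v ⟶ w) (h : G.d f = n) : X.X f →ₗ[ℂ] X.fibre n :=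
  Corr.L2Sum.single (E := X.summand n) (.mk f h)

/-- The inclusion `ι_α : X_α → Y_{d(α)}`. -/
def ι {v w : Λ} (f : v ⟶ w) : X.X f →ₗ[ℂ] X.fibre (G.d f) := X.incl f rfl

/-- The identification of `X_f` with `X_g` for equal paths `f` and `g`. -/
def castHom {v w : Λ} {f g : v ⟶ w} (h : f = g) : X.X f →ₗ[ℂ] X.X g := h ▸ LinearMap.id

lemma castHom_eq_iff {v w : Λ} {f g : v ⟶ w} (h : f = g) (x : X.X f) (y : X.X g) :
    X.castHom h x = y ↔ (⟨f, x⟩ : Σ g : v ⟶ w, X.X g) = ⟨g, y⟩ := by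
  subst h; simp [castHom]

end LambdaSystem

namespace LambdaSystem

variable {k : ℕ} {Λ : Type u} [SmallCategory Λ] {G : KGraph k Λ} (X : LambdaSystem G)

section Mul

variable {m n : Fin k → ℕ}

/-- The component `x_f ∈ X_f` of `x ∈ Yₙ`, for a path `f` of degree `n`. -/
def coord {u v : Λ} (f : u ⟶ v) (h : G.d f = n) : X.fibre n →ₗ[ℂ] X.X f where
  toFun x := (show Corr.L2Sum (X.summand n) from x) (.mk f h)
  map_add' _ _ := rfl
  map_smul' _ _ := rfl

lemma fibre_ext {x y : X.fibre n}
    (h : ∀ {u v : Λ} (f : u ⟶ v) (hf : G.d f = n), X.coord f hf x = X.coord f hf y) : x = y :=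
  Corr.L2Sum.ext fun l => h l.1.hom l.2

/-- The component `(xy)_{αβ} = χ_{α,β}(x_α ⊗ y_β)`, for `x ∈ Y_m` and `y ∈ Y_n`: every path of
degree `m + n` has a unique factorisation `αβ` with `d(α) = m` and `d(β) = n`. -/
def mulFam (l : G.PathOf (m + n)) : X.fibre m →ₗ[ℂ] X.fibre n →ₗ[ℂ] X.X l.1.hom :=
  let H := (G.factorisation l.1.hom m n l.2).exists
  ((X.χ H.choose.2.1 H.choose.2.2).compl₁₂ (X.coord _ H.choose_spec.1)
    (X.coord _ H.choose_spec.2.1)).compr₂ (X.castHom H.choose_spec.2.2)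

lemma mulFam_apply (x : X.fibre m) (y : X.fibre n) {u v w : Λ} (α : v ⟶ w) (β : u ⟶ v)
    (hα : G.d α = m) (hβ : G.d β = n) {f : u ⟶ w} (h : β ≫ α = f) (hf : G.d f = m + n) :
    X.mulFam (.mk f hf) x y = X.castHom h (X.χ α β (X.coord α hα x) (X.coord β hβ y)) := by
  have key : ∀ p : Σ v : Λ, (v ⟶ w) × (u ⟶ v), p = ⟨v, α, β⟩ →
      ∀ (h1 : G.d p.2.1 = m) (h2 : G.d p.2.2 = n) (h3 : p.2.2 ≫ p.2.1 = f),
      X.castHom h3 (X.χ p.2.1 p.2.2 (X.coord p.2.1 h1 x) (X.coord p.2.2 h2 y)) =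
        X.castHom h (X.χ α β (X.coord α hα x) (X.coord β hβ y)) := by
    rintro p rfl h1 h2 h3
    rfl
  let H := (G.factorisation f m n hf).exists
  exact key H.choose ((G.factorisation f m n hf).unique H.choose_spec ⟨hα, hβ, h⟩) _ _ _

/-- The unique factorisation of a path of degree `m + n`. -/
lemma exists_factor (l : G.PathOf (m + n)) : ∃ (u v w : Λ) (α : v ⟶ w) (β : u ⟶ v)
    (hα : G.d α = m) (hβ : G.d β = n),
    l = .mk (β ≫ α) (by rw [G.d_comp, hα, hβ]) := by
  obtain ⟨⟨f⟩, hl⟩ := l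
  obtain ⟨⟨v, α, β⟩, h1, h2, h3⟩ := (G.factorisation f m n hl).exists
  dsimp only at h1 h2 h3
  subst h3
  exact ⟨_, v, _, α, β, h1, h2, rfl⟩

/-- The factors `(α, β)` of a path `αβ` of degree `m + n`. -/
def split (l : G.PathOf (m + n)) : G.PathOf m × G.PathOf n :=
  let H := (G.factorisation l.1.hom m n l.2).exists
  (.mk _ H.choose_spec.1, .mk _ H.choose_spec.2.1)

lemma split_mk {u v w : Λ} (α : v ⟶ w) (β : u ⟶ v) (hα : G.d α = m) (hβ : G.d β = n)
    (hf : G.d (β ≫ α) = m + n) :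
    split (.mk (β ≫ α) hf) = (.mk α hα, .mk β hβ) := by
  have key : ∀ p : Σ v : Λ, (v ⟶ w) × (u ⟶ v), p = ⟨v, α, β⟩ →
      ∀ (h1 : G.d p.2.1 = m) (h2 : G.d p.2.2 = n),
      ((.mk p.2.1 h1, .mk p.2.2 h2) : G.PathOf m × G.PathOf n) = (.mk α hα, .mk β hβ) := by
    rintro p rfl h1 h2
    rfl
  let H := (G.factorisation (β ≫ α) m n hf).exists
  exact key H.choose ((G.factorisation (β ≫ α) m n hf).unique H.choose_spec ⟨hα, hβ, rfl⟩) _ _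

lemma split_injective : Function.Injective (split (G := G) (m := m) (n := n)) := by
  intro l l' h
  obtain ⟨u, v, w, α, β, hα, hβ, rfl⟩ := exists_factor l
  obtain ⟨u', v', w', α', β', hα', hβ', rfl⟩ := exists_factor l'
  rw [split_mk α β hα hβ, split_mk α' β' hα' hβ', Prod.mk.injEq] at h
  have h1 := congrArg Subtype.val h.1
  have h2 := congrArg Subtype.val h.2
  simp only [KPath.mk.injEq] at h1 h2
  obtain ⟨rfl, rfl, h1⟩ := h1
  obtain ⟨rfl, -, h2⟩ := h2
  obtain rfl := eq_of_heq h1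
  obtain rfl := eq_of_heq h2
  rfl

lemma hasSum_mulFam (x : X.fibre m) (y : X.fibre n) :
    HasSum (fun l => (X.summand (m + n) l).inner (X.mulFam l x y) (X.mulFam l x y))
      ((X.fibre n).inner y ((X.fibre n).φ ((X.fibre m).inner x x) y)) := by
  have h := Corr.hasSum_tensor (E := X.summand m) (F := X.summand n) x y
  rw [← split_injective.hasSum_iff] at h
  · change HasSum _ (Corr.L2Sum.inner y (Corr.L2Sum.φ (Corr.L2Sum.inner x x) y))
    convert h using 1
    funext l
    obtain ⟨u, v, w, α, β, hα, hβ, rfl⟩ := exists_factor l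
    rw [X.mulFam_apply x y α β hα hβ rfl, Function.comp_apply, split_mk α β hα hβ]
    change C0Sum.single u ((X.X (β ≫ α)).inner (X.χ α β _ _) (X.χ α β _ _)) =
      C0Sum.single u ((X.X β).inner _ ((X.X β).φ (C0Sum.eval v (C0Sum.single v _)) _))
    rw [C0Sum.eval_single_same, (X.χ_map α β).inner_map]
    rfl
  · rintro ⟨⟨⟨α⟩, hα⟩, ⟨⟨β⟩, hβ⟩⟩ hr
    rename_i v w u v'
    have hne : v' ≠ v := by
      rintro rfl
      exact hr ⟨.mk (β ≫ α) (by rw [G.d_comp, hα, hβ]), split_mk α β hα hβ _⟩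
    change C0Sum.single u ((X.X β).inner _ ((X.X β).φ (C0Sum.eval v' (C0Sum.single v _)) _)) = 0
    rw [C0Sum.eval_single_ne hne, map_zero]
    exact (congrArg _ (map_zero _)).trans (map_zero _)

/-- The multiplication `Y_m × Y_n → Y_{m+n}`. -/
def mul (m n : Fin k → ℕ) : X.fibre m →ₗ[ℂ] X.fibre n →ₗ[ℂ] X.fibre (m + n) :=
  LinearMap.mk₂ ℂ (fun x y => (show Corr.L2Sum (X.summand (m + n)) from
      ⟨fun l => X.mulFam l x y, (X.hasSum_mulFam x y).summable⟩))
    (fun x x' y => Corr.L2Sum.ext fun l => LinearMap.map_add₂ (X.mulFam l) x x' y)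
    (fun c x y => Corr.L2Sum.ext fun l => LinearMap.map_smul₂ (X.mulFam l) c x y)
    (fun x y y' => Corr.L2Sum.ext fun l => LinearMap.map_add (X.mulFam l x) y y')
    (fun c x y => Corr.L2Sum.ext fun l => LinearMap.map_smul (X.mulFam l x) c y)

lemma coord_mul (x : X.fibre m) (y : X.fibre n) {u v w : Λ} (α : v ⟶ w) (β : u ⟶ v)
    (hα : G.d α = m) (hβ : G.d β = n) {f : u ⟶ w} (h : β ≫ α = f) (hf : G.d f = m + n) :
    X.coord f hf (X.mul m n x y) = X.castHom h (X.χ α β (X.coord α hα x) (X.coord β hβ y)) :=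
  X.mulFam_apply x y α β hα hβ h hf

lemma inner_mul (x x' : X.fibre m) (y y' : X.fibre n) :
    (X.fibre (m + n)).inner (X.mul m n x y) (X.mul m n x' y') =
      (X.fibre n).inner y ((X.fibre n).φ ((X.fibre m).inner x x') y') := by
  have hdiag : ∀ (x : X.fibre m) (y : X.fibre n),
      (X.fibre (m + n)).inner (X.mul m n x y) (X.mul m n x y) =
      (X.fibre n).inner y ((X.fibre n).φ ((X.fibre m).inner x x) y) := by
    intro x y
    exact HasSum.unique (Corr.L2Sum.hasSum_inner _ _) (X.hasSum_mulFam x y)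
  have h1 : ∀ (x : X.fibre m) (y y' : X.fibre n),
      (X.fibre (m + n)).inner (X.mul m n x y) (X.mul m n x y') =
      (X.fibre n).inner y ((X.fibre n).φ ((X.fibre m).inner x x) y') := by
    intro x y y'
    rw [← sub_eq_zero]
    refine Corr.polarisation (fun y : X.fibre n =>
      (X.fibre (m + n)).inner (X.mul m n x y) ∘ₗ X.mul m n x -
      (X.fibre n).inner y ∘ₗ (X.fibre n).φ ((X.fibre m).inner x x)) ?_ ?_ ?_ y y'
    · intro a b c
      simp only [LinearMap.sub_apply, LinearMap.comp_apply, map_add,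
        (X.fibre _).isSemiInner.add_left]
      abel
    · intro c a b
      simp only [LinearMap.sub_apply, LinearMap.comp_apply, map_smul,
        (X.fibre _).isSemiInner.smul_left, smul_sub]
    · intro a
      simp only [LinearMap.sub_apply, LinearMap.comp_apply, hdiag, sub_self]
  rw [← sub_eq_zero]
  refine Corr.polarisation (fun x : X.fibre m =>
    (X.fibre (m + n)).inner (X.mul m n x y) ∘ₗ (X.mul m n).flip y' -
    (X.fibre n).inner y ∘ₗ (X.fibre n).φ.flip y' ∘ₗ (X.fibre m).inner x) ?_ ?_ ?_ x x'
  · intro a b c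
    simp only [LinearMap.sub_apply, LinearMap.comp_apply, map_add, LinearMap.flip_apply,
      LinearMap.add_apply, (X.fibre _).isSemiInner.add_left]
    abel
  · intro c a b
    simp only [LinearMap.sub_apply, LinearMap.comp_apply, map_smul, LinearMap.flip_apply,
      LinearMap.smul_apply, (X.fibre _).isSemiInner.smul_left, smul_sub]
  · intro a
    simp only [LinearMap.sub_apply, LinearMap.comp_apply, LinearMap.flip_apply, h1, sub_self]

lemma sigma_ext {p q : Fin k → ℕ} (h : p = q) (x : X.fibre p) (y : X.fibre q)
    (hxy : ∀ {u v : Λ} (f : u ⟶ v) (hp : G.d f = p) (hq : G.d f = q),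
      X.coord f hp x = X.coord f hq y) :
    (⟨p, x⟩ : Σ p, X.fibre p) = ⟨q, y⟩ := by
  subst h
  congr 1
  exact X.fibre_ext fun f hf => hxy f hf hf

lemma castHom_trans_eq {v w : Λ} {f g h : v ⟶ w} (hf : f = h) (hg : g = h) (x : X.X f) (y : X.X g)
    (e : (⟨f, x⟩ : Σ g : v ⟶ w, X.X g) = ⟨g, y⟩) : X.castHom hf x = X.castHom hg y := by
  subst hf
  exact (X.castHom_eq_iff hg y x).mpr e.symm |>.symm

lemma mul_assoc (l m n : Fin k → ℕ) (x : X.fibre l) (y : X.fibre m) (z : X.fibre n) :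
    (⟨_, X.mul _ _ (X.mul _ _ x y) z⟩ : Σ p, X.fibre p) = ⟨_, X.mul _ _ x (X.mul _ _ y z)⟩ := by
  refine X.sigma_ext (add_assoc l m n) _ _ fun f hp hq => ?_
  obtain ⟨⟨v, δ, γ⟩, hδ, hγ, rfl⟩ := (G.factorisation f (l + m) n hp).exists
  dsimp only at hδ hγ hp hq ⊢
  obtain ⟨⟨v', α, β⟩, hα, hβ, rfl⟩ := (G.factorisation δ l m hδ).exists
  dsimp only at hα hβ hδ hp hq ⊢
  rw [X.coord_mul _ z (β ≫ α) γ hδ hγ rfl, X.coord_mul x y α β hα hβ rfl,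
    X.coord_mul x _ α (γ ≫ β) hα (by rw [G.d_comp, hβ, hγ]) (Category.assoc _ _ _),
    X.coord_mul y z β γ hβ hγ rfl]
  exact X.castHom_trans_eq _ _ _ _ (X.χ_assoc α β γ _ _ _)

end Mul

section Unit

/-- `X_f` is the identity correspondence if `f` is an identity morphism. -/
def idMap {u v : Λ} (f : u ⟶ v) (e : u = v) (h : f = eqToHom e) : X.A u →ₗ[ℂ] X.X f := by
  subst e
  exact X.castHom (f := 𝟙 u) h.symm ∘ₗ X.unit u

lemma idMap_id (v : Λ) (e : v = v) (h : 𝟙 v = eqToHom e) : X.idMap (𝟙 v) e h = X.unit v := rfl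

lemma hasSum_C0Sum {V : Type u} {A : V → Type u} [∀ v, NonUnitalCStarAlgebra (A v)]
    (a : C0Sum A) : HasSum (fun v => C0Sum.single v (C0Sum.eval v a)) a := by
  classical
  refine Metric.tendsto_atTop.mpr fun ε hε => ?_
  have ha : ∀ᶠ v in cofinite, ‖C0Sum.eval v a‖ < ε / 2 := by
    have : Tendsto (fun v => ‖C0Sum.eval v a‖) cofinite (𝓝 0) := a.2
    exact this.eventually (gt_mem_nhds (by positivity))
  rw [eventually_cofinite] at ha
  refine ⟨ha.toFinset, fun F hF => lt_of_le_of_lt ?_ (half_lt_self hε)⟩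
  rw [dist_comm, dist_eq_norm]
  refine lp.norm_le_of_forall_le (E := A) (by positivity) fun w => ?_
  change ‖C0Sum.eval w (a - ∑ v ∈ F, C0Sum.single v (C0Sum.eval v a))‖ ≤ ε / 2
  rw [map_sub, map_sum]
  by_cases hw : w ∈ F
  · rw [Finset.sum_eq_single w (fun v _ hv => C0Sum.eval_single_ne hv.symm _)
      (fun h => absurd hw h), C0Sum.eval_single_same, sub_self, norm_zero]
    positivity
  · rw [Finset.sum_eq_zero (fun v hv => C0Sum.eval_single_ne (by rintro rfl; exact hw hv) _),
      sub_zero]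
    by_contra hlt
    exact hw (hF (by simpa using (not_le.mp hlt).le))

/-- Vertices are the paths of degree `0`. -/
def vertexEquiv (G : KGraph k Λ) : Λ ≃ G.PathOf 0 where
  toFun v := .mk (𝟙 v) (G.d_id v)
  invFun l := l.1.src
  left_inv _ := rfl
  right_inv l := by
    obtain ⟨⟨f⟩, h⟩ := l
    obtain ⟨rfl, rfl⟩ := G.eq_id f h
    rfl

/-- The element of `Y₀ = ⨁ᵥ Xᵥ` corresponding to `a ∈ A = ⨁ᵥ Aᵥ`. -/
def unitFam (l : G.PathOf 0) : X.algA →ₗ[ℂ] X.X l.1.hom :=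
  X.idMap l.1.hom (G.eq_id l.1.hom l.2).choose (G.eq_id l.1.hom l.2).choose_spec ∘ₗ
    C0Sum.evalₗ l.1.src

lemma unitFam_id (v : Λ) (h : G.d (𝟙 v) = 0) (a : X.algA) :
    X.unitFam (.mk (𝟙 v) h) a = X.unit v (C0Sum.eval v a) := rfl

lemma hasSum_unitFam (a b : X.algA) :
    HasSum (fun l => (X.summand 0 l).inner (X.unitFam l a) (X.unitFam l b)) (star a * b) := by
  rw [← (vertexEquiv G).hasSum_iff]
  convert hasSum_C0Sum (star a * b) using 1
  funext v
  change C0Sum.single v ((X.X (𝟙 v)).inner (X.unit v (C0Sum.eval v a))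
    (X.unit v (C0Sum.eval v b))) = _
  rw [(X.isIdentity v).inner_map, map_mul (C0Sum.eval v), map_star (C0Sum.eval v)]

/-- The identification of `A = ⨁ᵥ Aᵥ` with `Y₀ = ⨁ᵥ Xᵥ`. -/
def unitMap : X.algA →ₗ[ℂ] X.fibre 0 where
  toFun a := show Corr.L2Sum (X.summand 0) from
    ⟨fun l => X.unitFam l a, (X.hasSum_unitFam a a).summable⟩
  map_add' a b := Corr.L2Sum.ext fun l => map_add (X.unitFam l) a b
  map_smul' c a := Corr.L2Sum.ext fun l => map_smul (X.unitFam l) c a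

lemma coord_unitMap (v : Λ) (h : G.d (𝟙 v) = 0) (a : X.algA) :
    X.coord (𝟙 v) h (X.unitMap a) = X.unit v (C0Sum.eval v a) := rfl

lemma fibre_zero_ext {x y : X.fibre 0}
    (h : ∀ v, X.coord (𝟙 v) (G.d_id v) x = X.coord (𝟙 v) (G.d_id v) y) : x = y := by
  refine X.fibre_ext fun f hf => ?_
  obtain ⟨rfl, rfl⟩ := G.eq_id f hf
  exact h _

lemma norm_unit (v : Λ) (a : X.A v) : ‖X.unit v a‖ = ‖a‖ := by
  rw [(X.X (𝟙 v)).norm_eq, (X.isIdentity v).inner_map, CStarRing.norm_star_mul_self,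
    Real.sqrt_mul_self (norm_nonneg _)]

lemma isIdentity_unitMap : (X.fibre 0).IsIdentity X.unitMap where
  surjective y := by
    choose a ha using fun v => (X.isIdentity v).surjective (X.coord (𝟙 v) (G.d_id v) y)
    let y' : Corr.L2Sum (X.summand 0) := y
    have hn : ∀ v, ‖a v‖ = ‖y' (vertexEquiv G v)‖ := fun v => by
      rw [← X.norm_unit, ha]; rfl
    have hmem : Memℓp a ∞ := by
      refine memℓp_infty ⟨‖y'‖, ?_⟩
      rintro _ ⟨v, rfl⟩
      exact (hn v).trans_le (Corr.L2Sum.norm_apply_le y' _)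
    have hc0 : Tendsto (fun v => ‖a v‖) cofinite (𝓝 0) := by
      have h1 : Tendsto (fun l => ‖(X.summand 0 l).inner (y' l) (y' l)‖) cofinite (𝓝 0) := by
        simpa using (Corr.L2Sum.summable_inner y' y').tendsto_cofinite_zero.norm
      have h2 := (h1.comp (vertexEquiv G).injective.tendsto_cofinite).sqrt
      rw [Real.sqrt_zero] at h2
      refine h2.congr fun v => ?_
      rw [hn]
      exact ((X.summand 0 _).norm_eq _).symm
    let b : C0Sum X.A := show c0Sub X.A from ⟨⟨a, hmem⟩, hc0⟩
    exact ⟨b, X.fibre_zero_ext fun v => (X.coord_unitMap v (G.d_id v) b).trans (ha v)⟩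
  inner_map a b := HasSum.unique (Corr.L2Sum.hasSum_inner _ _) (X.hasSum_unitFam a b)
  φ_map a b := X.fibre_zero_ext fun v => by
    rw [X.coord_unitMap, map_mul, ← (X.isIdentity v).φ_map]
    rfl
  rsmul_map a b := X.fibre_zero_ext fun v => by
    rw [X.coord_unitMap, map_mul, ← (X.isIdentity v).rsmul_map]
    rfl

lemma unit_mul (n : Fin k → ℕ) (a : X.algA) (x : X.fibre n) :
    (⟨_, X.mul _ _ (X.unitMap a) x⟩ : Σ p, X.fibre p) = ⟨_, (X.fibre n).φ a x⟩ := by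
  refine X.sigma_ext (zero_add n) _ _ fun f hp hq => ?_
  rw [X.coord_mul _ x (𝟙 _) f (G.d_id _) hq (Category.comp_id f), X.coord_unitMap,
    X.castHom_eq_iff, X.χ_left]
  rfl

lemma mul_unit (n : Fin k → ℕ) (x : X.fibre n) (a : X.algA) :
    (⟨_, X.mul _ _ x (X.unitMap a)⟩ : Σ p, X.fibre p) = ⟨_, (X.fibre n).rsmul x a⟩ := by
  refine X.sigma_ext (add_zero n) _ _ fun f hp hq => ?_
  rw [X.coord_mul x _ f (𝟙 _) hq (G.d_id _) (Category.id_comp f), X.coord_unitMap,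
    X.castHom_eq_iff, X.χ_right]
  rfl

end Unit

section System

lemma coord_incl_same {n : Fin k → ℕ} {v w : Λ} (f : v ⟶ w) (h : G.d f = n) (x : X.X f) :
    X.coord f h (X.incl f h x) = x :=
  Corr.L2Sum.single_same (E := X.summand n) (.mk f h) x

lemma coord_incl_ne {n : Fin k → ℕ} {v w v' w' : Λ} (f : v ⟶ w) (h : G.d f = n)
    (g : v' ⟶ w') (h' : G.d g = n) (hne : (KGraph.PathOf.mk g h' : G.PathOf n) ≠ .mk f h)
    (x : X.X f) : X.coord g h' (X.incl f h x) = 0 :=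
  Corr.L2Sum.single_ne (E := X.summand n) hne x

lemma continuous_incl {n : Fin k → ℕ} {v w : Λ} (f : v ⟶ w) (h : G.d f = n) :
    Continuous (X.incl f h) :=
  (AddMonoidHomClass.isometry_of_norm (X.incl f h) fun x =>
    Corr.L2Sum.norm_single (E := X.summand n) (.mk f h) x).continuous

/-- `ι_α(x) ι_β(y) = ι_{αβ}(χ_{α,β}(x ⊗ y))` if `s(α) = r(β)`. -/
lemma incl_mul_incl {m n : Fin k → ℕ} {u v w : Λ} (α : v ⟶ w) (β : u ⟶ v) (hα : G.d α = m)
    (hβ : G.d β = n) (hf : G.d (β ≫ α) = m + n) (x : X.X α) (y : X.X β) :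
    X.mul m n (X.incl α hα x) (X.incl β hβ y) = X.incl (β ≫ α) hf (X.χ α β x y) := by
  refine Corr.L2Sum.ext fun l => ?_
  obtain ⟨u', v', w', α', β', hα', hβ', rfl⟩ := exists_factor l
  have hf' : G.d (β' ≫ α') = m + n := by rw [G.d_comp, hα', hβ']
  refine (X.coord_mul _ _ α' β' hα' hβ' rfl hf').trans ?_
  change X.χ α' β' _ _ = X.coord (β' ≫ α') hf' (X.incl (β ≫ α) hf (X.χ α β x y))
  by_cases h : (KGraph.PathOf.mk (β' ≫ α') hf' : G.PathOf (m + n)) = .mk (β ≫ α) hf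
  · have h' := congrArg split h
    rw [split_mk α β hα hβ, split_mk α' β' hα' hβ', Prod.mk.injEq] at h'
    have h1 := congrArg Subtype.val h'.1
    have h2 := congrArg Subtype.val h'.2
    simp only [KPath.mk.injEq] at h1 h2
    obtain ⟨rfl, rfl, h1⟩ := h1
    obtain ⟨rfl, -, h2⟩ := h2
    obtain rfl := eq_of_heq h1
    obtain rfl := eq_of_heq h2
    rw [coord_incl_same, coord_incl_same, coord_incl_same]
  · rw [X.coord_incl_ne _ _ _ _ h]
    by_cases h1 : (KGraph.PathOf.mk α' hα' : G.PathOf m) = .mk α hα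
    · by_cases h2 : (KGraph.PathOf.mk β' hβ' : G.PathOf n) = .mk β hβ
      · refine absurd (split_injective ?_) h
        rw [split_mk α β hα hβ, split_mk α' β' hα' hβ', h1, h2]
      · rw [X.coord_incl_ne _ _ _ _ h2, map_zero]
    · rw [X.coord_incl_ne _ _ _ _ h1, map_zero, LinearMap.zero_apply]

/-- `ι_α(x) ι_β(y) = 0` if `s(α) ≠ r(β)`. -/
lemma incl_mul_incl_eq_zero {m n : Fin k → ℕ} {u v v' w : Λ} (α : v ⟶ w) (β : u ⟶ v')
    (hα : G.d α = m) (hβ : G.d β = n) (hne : v ≠ v') (x : X.X α) (y : X.X β) :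
    X.mul m n (X.incl α hα x) (X.incl β hβ y) = 0 := by
  refine Corr.L2Sum.ext fun l => ?_
  obtain ⟨u₁, v₁, w₁, α', β', hα', hβ', rfl⟩ := exists_factor l
  refine (X.coord_mul _ _ α' β' hα' hβ' rfl (by rw [G.d_comp, hα', hβ'])).trans ?_
  change X.χ α' β' _ _ = 0
  by_cases h1 : (KGraph.PathOf.mk α' hα' : G.PathOf m) = .mk α hα
  · by_cases h2 : (KGraph.PathOf.mk β' hβ' : G.PathOf n) = .mk β hβ
    · have h1 := congrArg (fun l => l.1.src) h1
      have h2 := congrArg (fun l => l.1.rng) h2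
      exact absurd (h1.symm.trans h2) hne
    · rw [X.coord_incl_ne _ _ _ _ h2, map_zero]
  · rw [X.coord_incl_ne _ _ _ _ h1, map_zero, LinearMap.zero_apply]

lemma isTensorIso_mul (m n : Fin k → ℕ) (hm : m ≠ 0) : Corr.IsTensorIso (X.mul m n) where
  inner_map x y x' y' := X.inner_mul x x' y y'
  map_φ a x y := by
    refine Corr.L2Sum.ext fun l => ?_
    obtain ⟨u, v, w, α, β, hα, hβ, rfl⟩ := exists_factor l
    have h1 := X.coord_mul ((X.fibre m).φ a x) y α β hα hβ rfl (by rw [G.d_comp, hα, hβ])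
    have h2 := X.coord_mul x y α β hα hβ rfl (by rw [G.d_comp, hα, hβ])
    refine h1.trans (Eq.trans ?_ (congrArg ((X.X (β ≫ α)).φ (C0Sum.eval w a)) h2.symm))
    exact (X.χ_map α β).map_φ _ _ _
  map_rsmul x y a := by
    refine Corr.L2Sum.ext fun l => ?_
    obtain ⟨u, v, w, α, β, hα, hβ, rfl⟩ := exists_factor l
    have h1 := X.coord_mul x ((X.fibre n).rsmul y a) α β hα hβ rfl (by rw [G.d_comp, hα, hβ])
    have h2 := X.coord_mul x y α β hα hβ rfl (by rw [G.d_comp, hα, hβ])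
    refine h1.trans (Eq.trans ?_ (congrArg
      (fun z => (X.X (β ≫ α)).rsmul z (C0Sum.eval u a)) h2.symm))
    exact (X.χ_map α β).map_rsmul _ _ _
  dense := by
    refine Corr.L2Sum.dense_of_single _ fun l z => ?_
    obtain ⟨u, v, w, α, β, hα, hβ, rfl⟩ := exists_factor l
    have hd := (X.χ_iso α β (by rwa [hα])).dense z
    have hf : G.d (β ≫ α) = m + n := by rw [G.d_comp, hα, hβ]
    have hmaps : Set.MapsTo (X.incl (β ≫ α) hf)
        (Submodule.span ℂ {z | ∃ x y, z = X.χ α β x y} : Set (X.X (β ≫ α)))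
        (Submodule.span ℂ {z | ∃ x y, z = X.mul m n x y} : Set (X.fibre (m + n))) := ?_
    · exact map_mem_closure (X.continuous_incl (β ≫ α) hf) hd hmaps
    intro z hz
    refine Submodule.span_induction (p := fun z _ =>
      X.incl (β ≫ α) hf z ∈ Submodule.span ℂ {z | ∃ x y, z = X.mul m n x y})
      ?_ ?_ ?_ ?_ hz
    · rintro _ ⟨x, y, rfl⟩
      exact Submodule.subset_span ⟨X.incl α hα x, X.incl β hβ y,
        (X.incl_mul_incl α β hα hβ hf x y).symm⟩
    · rw [map_zero]; exact Submodule.zero_mem _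
    · intro a b _ _ ha hb
      rw [map_add]; exact Submodule.add_mem _ ha hb
    · intro c a _ ha
      rw [map_smul]; exact Submodule.smul_mem _ _ ha

/-- The product system `Y_X` over `ℕᵏ` associated to a `Λ`-system `X`. -/
def productSystem : ProductSystem (Fin k → ℕ) X.algA where
  Y := X.fibre
  mul := X.mul
  mul_assoc := X.mul_assoc
  unit := X.unitMap
  isIdentity := X.isIdentity_unitMap
  unit_mul := X.unit_mul
  mul_unit := X.mul_unit
  isTensorIso m n hm _ := X.isTensorIso_mul m n hm

end System

end LambdaSystem

namespace LambdaSystem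

variable {k : ℕ} {Λ : Type u} [SmallCategory Λ] {G : KGraph k Λ} (X : LambdaSystem G)

/-- The inclusion `ι_v : A_v → A = Y₀`. -/
def ιVertex (v : Λ) : X.A v →ₗ[ℂ] X.fibre 0 := X.unitMap ∘ₗ C0Sum.singleₗ v

/-- `(ρ, π)` is given by `ρ_α = ψ ∘ ι_α` and `π_v = ψ ∘ ι_v`, that is, `(ρ, π) = (ρ^ψ, π^ψ)`. -/
def Rep.IsInducedBy {X : LambdaSystem G} {B : Type u} [NonUnitalCStarAlgebra B] (R : X.Rep B)
    (ψ : X.productSystem.Rep B) : Prop :=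
  (∀ {v w : Λ} (f : v ⟶ w) (x : X.X f), R.ρ f x = ψ.ψ (G.d f) (X.ι f x)) ∧
    ∀ (v : Λ) (a : X.A v), R.π v a = ψ.ψ 0 (X.ιVertex v a)

end LambdaSystem

end

/-!
A representation of `Y` is contractive on each fibre `Yₙ`, hence determined by its restrictions to
the summands `X_λ`, on which the relations of a representation of `Y` are those of a representation
of `X`. Conversely, if `(ρ, π)` represents `X`, the maps `ρ_λ`, `λ ∈ Λⁿ`, have mutually
orthogonal ranges, so that `‖∑ ρ_λ(x_λ)‖² = ‖π(∑ ⟨x_λ, x_λ⟩)‖ ≤ ‖∑ ⟨x_λ, x_λ⟩‖` for finite sums.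
Hence `x ↦ ∑ ρ_λ(x_λ)` converges on all of `Yₙ`, and by continuity its multiplicativity need only be
checked on summands.

The Toeplitz algebra is generated by the diagonal image of `Y` in the product of sufficiently many
representations: one for each norm that a representation induces on the free algebra on the elements
of `Y` and their adjoints. Its universal property is carried over to `X` by the bijection.
-/

noncomputable section

open scoped CStarAlgebra

lemma dense_adjoin_preimage_val {T : Type*} [NonUnitalCStarAlgebra T] (s : Set T) :
    Dense (NonUnitalStarAlgebra.adjoin ℂ
      (Subtype.val ⁻¹' s : Set (NonUnitalStarAlgebra.adjoin ℂ s).topologicalClosure) :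
        Set (NonUnitalStarAlgebra.adjoin ℂ s).topologicalClosure) := by
  let S := NonUnitalStarAlgebra.adjoin ℂ s
  have hs : s ⊆ S.topologicalClosure :=
    (NonUnitalStarAlgebra.subset_adjoin ℂ s).trans S.le_topologicalClosure
  have himage : (NonUnitalStarAlgebra.adjoin ℂ (Subtype.val ⁻¹' s)).map
      (NonUnitalStarSubalgebraClass.subtype S.topologicalClosure) = S := by
    rw [NonUnitalStarAlgHom.map_adjoin]
    exact congrArg _ ((Subtype.image_preimage_val _ s).trans (Set.inter_eq_right.mpr hs))
  intro t
  rw [closure_subtype]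
  have ht : (t : T) ∈ closure (S : Set T) := t.2
  rwa [← himage] at ht

section

variable {T C : Type*} [NonUnitalCStarAlgebra T] [NonUnitalCStarAlgebra C]

lemma starAlgHom_ext_of_dense_adjoin {s : Set T}
    (hs : Dense (NonUnitalStarAlgebra.adjoin ℂ s : Set T)) {Φ Ψ : T →⋆ₙₐ[ℂ] C}
    (h : Set.EqOn Φ Ψ s) : Φ = Ψ := by
  have hle : NonUnitalStarAlgebra.adjoin ℂ s ≤ NonUnitalStarAlgHom.equalizer Φ Ψ :=
    NonUnitalStarAlgebra.adjoin_le h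
  exact DFunLike.coe_injective (Continuous.ext_on hs (map_continuous Φ) (map_continuous Ψ) hle)

lemma exists_starAlgHom_extension {F : Type*} [NonUnitalNonAssocRing F] [Module ℂ F] [Star F]
    (f : F →⋆ₙₐ[ℂ] T) (g : F →⋆ₙₐ[ℂ] C) (hf : DenseRange f) (hle : ∀ x, ‖g x‖ ≤ ‖f x‖) :
    ∃ Φ : T →⋆ₙₐ[ℂ] C, ∀ x, Φ (f x) = g x := by
  let Φ : T →L[ℂ] C := (g : F →ₗ[ℂ] C).extendOfNorm (f : F →ₗ[ℂ] T)
  have hΦ (x : F) : Φ (f x) = g x :=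
    LinearMap.extendOfNorm_eq (f := (g : F →ₗ[ℂ] C)) (e := (f : F →ₗ[ℂ] T)) hf
      ⟨1, fun x => (hle x).trans_eq (one_mul _).symm⟩ x
  have hmul (a b : T) : Φ (a * b) = Φ a * Φ b :=
    hf.induction_on₂ (p := fun a b => Φ (a * b) = Φ a * Φ b)
      (isClosed_eq (by fun_prop) (by fun_prop))
      (fun x y => by rw [← map_mul, hΦ, hΦ, hΦ, map_mul]) a b
  have hstar (a : T) : Φ (star a) = star (Φ a) :=
    hf.induction_on (p := fun a => Φ (star a) = star (Φ a)) a
      (isClosed_eq (by fun_prop) (by fun_prop))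
      fun x => by rw [← map_star, hΦ, hΦ, map_star]
  exact ⟨{ (Φ : T →ₗ[ℂ] C) with
    map_zero' := map_zero Φ, map_mul' := hmul, map_star' := hstar }, hΦ⟩

end

section StarEval

variable {S B C : Type*} [NonUnitalCStarAlgebra B] [NonUnitalCStarAlgebra C]

/-- Evaluation of noncommutative `*`-polynomials at a family `f`: the two copies of `S` in the free
algebra are the variables and their adjoints. -/
def starEval (f : S → B) : FreeNonUnitalNonAssocAlgebra ℂ (S ⊕ S) →ₙₐ[ℂ] B :=
  FreeNonUnitalNonAssocAlgebra.lift ℂ (Sum.elim f (star f))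

lemma starEval_inl (f : S → B) (s : S) : starEval f (.of ℂ (.inl s)) = f s :=
  FreeNonUnitalNonAssocAlgebra.lift_of_apply _ _ _

lemma starEval_inr (f : S → B) (s : S) : starEval f (.of ℂ (.inr s)) = star (f s) :=
  FreeNonUnitalNonAssocAlgebra.lift_of_apply _ _ _

lemma starEval_comp (Φ : B →⋆ₙₐ[ℂ] C) (f : S → B) :
    starEval (Φ ∘ f) = (Φ : B →ₙₐ[ℂ] C).comp (starEval f) := by
  refine FreeNonUnitalNonAssocAlgebra.hom_ext ℂ fun s => ?_
  cases s with
  | inl s => exact (starEval_inl _ s).trans (congrArg Φ (starEval_inl f s)).symm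
  | inr s =>
    exact (starEval_inr _ s).trans ((map_star Φ _).symm.trans (congrArg Φ (starEval_inr f s)).symm)

lemma starEval_comp_apply (Φ : B →⋆ₙₐ[ℂ] C) (f : S → B)
    (x : FreeNonUnitalNonAssocAlgebra ℂ (S ⊕ S)) :
    starEval (Φ ∘ f) x = Φ (starEval f x) :=
  DFunLike.congr_fun (starEval_comp Φ f) x

lemma adjoin_range_subset_range_starEval (f : S → B) :
    (NonUnitalStarAlgebra.adjoin ℂ (Set.range f) : Set B) ⊆ Set.range (starEval f) := by
  change NonUnitalAlgebra.adjoin ℂ (Set.range f ∪ star (Set.range f)) ≤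
    NonUnitalAlgHom.range (starEval f)
  rw [NonUnitalAlgebra.adjoin_le_iff]
  rintro t (⟨s, rfl⟩ | ⟨s, hs⟩)
  · exact ⟨_, starEval_inl f s⟩
  · exact ⟨_, (starEval_inr f s).trans (by rw [hs, star_star])⟩

lemma exists_starAlgHom_of_norm_starEval_le {f : S → B} {g : S → C}
    (hf : Dense (NonUnitalStarAlgebra.adjoin ℂ (Set.range f) : Set B))
    (hle : ∀ x, ‖starEval g x‖ ≤ ‖starEval f x‖) : ∃ Φ : B →⋆ₙₐ[ℂ] C, ∀ s, Φ (f s) = g s := by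
  let graph := NonUnitalStarAlgebra.adjoin ℂ (Set.range fun s => (f s, g s))
  let fst : graph →⋆ₙₐ[ℂ] B :=
    (NonUnitalStarAlgHom.fst ℂ B C).comp (NonUnitalStarSubalgebraClass.subtype graph)
  let snd : graph →⋆ₙₐ[ℂ] C :=
    (NonUnitalStarAlgHom.snd ℂ B C).comp (NonUnitalStarSubalgebraClass.subtype graph)
  have hpair (s : S) : (f s, g s) ∈ graph := NonUnitalStarAlgebra.subset_adjoin ℂ _ ⟨s, rfl⟩
  have hdense : DenseRange fst := by
    refine hf.mono (NonUnitalStarAlgebra.adjoin_le (S := NonUnitalStarAlgHom.range fst) ?_)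
    rintro _ ⟨s, rfl⟩
    exact ⟨⟨_, hpair s⟩, rfl⟩
  have hnorm (t : graph) : ‖snd t‖ ≤ ‖fst t‖ := by
    obtain ⟨x, hx⟩ := adjoin_range_subset_range_starEval _ t.2
    have hfst : fst t = starEval f x :=
      (congrArg Prod.fst hx.symm).trans
        (starEval_comp_apply (NonUnitalStarAlgHom.fst ℂ B C) _ x).symm
    have hsnd : snd t = starEval g x :=
      (congrArg Prod.snd hx.symm).trans
        (starEval_comp_apply (NonUnitalStarAlgHom.snd ℂ B C) _ x).symm
    rw [hfst, hsnd]
    exact hle x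
  obtain ⟨Φ, hΦ⟩ := exists_starAlgHom_extension fst snd hdense hnorm
  exact ⟨Φ, fun s => hΦ ⟨_, hpair s⟩⟩

end StarEval

/-- A relation on families of elements of `C*`-algebras indexed by `S` that admits a universal
family: it bounds the norms of the members, and it can be checked in the coordinates of a
subdirect product. -/
structure CStarRelation (S : Type u) where
  Holds : ∀ {B : Type u} [NonUnitalCStarAlgebra B], (S → B) → Prop
  bound : S → ℝ
  norm_le_bound : ∀ {B : Type u} [NonUnitalCStarAlgebra B] {f : S → B}, Holds f →
    ∀ s, ‖f s‖ ≤ bound s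
  of_jointly_injective : ∀ {B : Type u} [NonUnitalCStarAlgebra B] {I : Type u} {D : I → Type u}
    [∀ i, NonUnitalCStarAlgebra (D i)] (Φ : ∀ i, B →⋆ₙₐ[ℂ] D i),
    (∀ a b, (∀ i, Φ i a = Φ i b) → a = b) → ∀ {f : S → B}, (∀ i, Holds (Φ i ∘ f)) → Holds f

/-- The coordinate homomorphism on an `ℓ^∞`-product of `C*`-algebras. -/
def lpEval {I : Type*} (D : I → Type*) [∀ i, NonUnitalCStarAlgebra (D i)] (i : I) :
    lp D ∞ →⋆ₙₐ[ℂ] D i where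
  toFun t := t i
  map_smul' _ _ := rfl
  map_zero' := rfl
  map_add' _ _ := rfl
  map_mul' _ _ := rfl
  map_star' _ := rfl

namespace CStarRelation

variable {S : Type u}

/-- The norms that families satisfying the relation induce on the `*`-polynomials. In contrast to
the families themselves, they form a set in the universe of `S`. -/
def seminorms (r : CStarRelation S) : Set (FreeNonUnitalNonAssocAlgebra ℂ (S ⊕ S) → ℝ) :=
  {N | ∃ (B : Type u) (_ : NonUnitalCStarAlgebra B) (f : S → B),
    r.Holds f ∧ ∀ x, N x = ‖starEval f x‖}

theorem exists_universal (r : CStarRelation S) :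
    ∃ (T : Type u) (_ : NonUnitalCStarAlgebra T) (f : S → T), r.Holds f ∧
      Dense (NonUnitalStarAlgebra.adjoin ℂ (Set.range f) : Set T) ∧
      ∀ (C : Type u) [NonUnitalCStarAlgebra C] (g : S → C), r.Holds g →
        ∃ Φ : T →⋆ₙₐ[ℂ] C, ∀ s, Φ (f s) = g s := by
  choose D instD fD hfD hnorm using fun N : r.seminorms => N.2
  let j (s : S) : lp D ∞ := ⟨fun N => fD N s, memℓp_infty ⟨r.bound s, by
    rintro _ ⟨N, rfl⟩
    exact r.norm_le_bound (hfD N) s⟩⟩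
  let T := (NonUnitalStarAlgebra.adjoin ℂ (Set.range j)).topologicalClosure
  have : IsClosed (T : Set (lp D ∞)) := NonUnitalStarSubalgebra.isClosed_topologicalClosure _
  let f (s : S) : T := ⟨j s,
    NonUnitalStarSubalgebra.le_topologicalClosure _
      (NonUnitalStarAlgebra.subset_adjoin ℂ _ ⟨s, rfl⟩)⟩
  let coord (N : r.seminorms) : T →⋆ₙₐ[ℂ] D N :=
    (lpEval D N).comp (NonUnitalStarSubalgebraClass.subtype T)
  have hrange : Set.range f = Subtype.val ⁻¹' Set.range j :=
    Set.ext fun t => exists_congr fun s => Subtype.ext_iff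
  have hdense : Dense (NonUnitalStarAlgebra.adjoin ℂ (Set.range f) : Set T) := by
    rw [hrange]
    exact dense_adjoin_preimage_val (Set.range j)
  refine ⟨T, inferInstance, f, r.of_jointly_injective coord
    (fun a b h => Subtype.ext (lp.ext (funext h))) hfD, hdense, fun C _ g hg => ?_⟩
  refine exists_starAlgHom_of_norm_starEval_le hdense fun x => ?_
  let N : r.seminorms := ⟨fun x => ‖starEval g x‖, C, inferInstance, g, hg, fun _ => rfl⟩
  calc ‖starEval g x‖ = ‖starEval (coord N ∘ f) x‖ := hnorm N x
    _ = ‖coord N (starEval f x)‖ := by rw [starEval_comp_apply]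
    _ ≤ ‖starEval f x‖ := NonUnitalStarAlgHom.norm_apply_le _ _

end CStarRelation

section IsRep

variable {A B : Type u} [NonUnitalCStarAlgebra A] [NonUnitalCStarAlgebra B]

namespace Corr.IsRep

variable {E : Corr A A} {t : E →ₗ[ℂ] B} {π : A →⋆ₙₐ[ℂ] B}

lemma norm_le (h : E.IsRep t π) (x : E) : ‖t x‖ ≤ ‖x‖ := by
  refine le_of_sq_le_sq ?_ (norm_nonneg x)
  rw [E.norm_sq, pow_two, ← CStarRing.norm_star_mul_self, ← h.map_inner]
  exact NonUnitalStarAlgHom.norm_apply_le π _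

lemma continuous (h : E.IsRep t π) : Continuous t :=
  AddMonoidHomClass.continuous_of_bound t 1 fun x => by simpa using h.norm_le x

lemma of_map_inner (hφ : ∀ a x, t (E.φ a x) = π a * t x)
    (hinner : ∀ x y, π (E.inner x y) = star (t x) * t y) : E.IsRep t π where
  map_φ := hφ
  map_rsmul x a := by
    have h₁ : star (t (E.rsmul x a)) * t x = star (π a) * star (t x) * t x := by
      rw [← hinner, E.isSemiInner.rsmul_left, map_mul, map_star, hinner, mul_assoc]
    have h₂ (z : E) : star (t z) * t (E.rsmul x a) = star (t z) * t x * π a := by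
      rw [← hinner, E.inner_rsmul, map_mul, hinner]
    have h₃ : star (π a) * star (t x) * t (E.rsmul x a) = star (π a) * star (t x) * t x * π a := by
      rw [mul_assoc, h₂, ← mul_assoc, ← mul_assoc]
    rw [← sub_eq_zero, ← CStarRing.star_mul_self_eq_zero_iff]
    simp only [star_sub, star_mul, sub_mul, mul_sub, ← mul_assoc, h₁, h₂, h₃, sub_self, zero_mul]
  map_inner := hinner

lemma map {C : Type u} [NonUnitalCStarAlgebra C] (h : E.IsRep t π) (Φ : B →⋆ₙₐ[ℂ] C) :
    E.IsRep ((Φ : B →ₗ[ℂ] C) ∘ₗ t) (Φ.comp π) where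
  map_φ a x := (congrArg Φ (h.map_φ a x)).trans (map_mul Φ _ _)
  map_rsmul x a := (congrArg Φ (h.map_rsmul x a)).trans (map_mul Φ _ _)
  map_inner x y :=
    (congrArg Φ (h.map_inner x y)).trans ((map_mul Φ _ _).trans (by rw [map_star]; rfl))

end Corr.IsRep

end IsRep

namespace ProductSystem.Rep

variable {P : Type} [AddMonoid P] {A : Type u} [NonUnitalCStarAlgebra A] {Y : ProductSystem P A}
  {B C : Type u} [NonUnitalCStarAlgebra B] [NonUnitalCStarAlgebra C]

lemma ext_of_ψ {φ ψ : Y.Rep B} (h : ∀ p, φ.ψ p = ψ.ψ p) : φ = ψ := by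
  obtain ⟨f, f₀, hf, _, _⟩ := φ
  obtain ⟨g, g₀, hg, _, _⟩ := ψ
  obtain rfl : f = g := funext h
  obtain rfl : f₀ = g₀ := NonUnitalStarAlgHom.ext fun a => (hf a).symm.trans (hg a)
  rfl

/-- The composite of a representation in `B` with a `*`-homomorphism `B → C`. -/
def map (Φ : B →⋆ₙₐ[ℂ] C) (ψ : Y.Rep B) : Y.Rep C where
  ψ p := (Φ : B →ₗ[ℂ] C) ∘ₗ ψ.ψ p
  ψe := Φ.comp ψ.ψe
  ψ_unit a := congrArg Φ (ψ.ψ_unit a)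
  isRep p := (ψ.isRep p).map Φ
  map_mul p q x y := (congrArg Φ (ψ.map_mul p q x y)).trans (_root_.map_mul Φ _ _)

lemma exists_of_jointly_injective {I : Type u} {D : I → Type u} [∀ i, NonUnitalCStarAlgebra (D i)]
    (Φ : ∀ i, B →⋆ₙₐ[ℂ] D i) (hΦ : ∀ a b, (∀ i, Φ i a = Φ i b) → a = b)
    (f : (Σ p, Y.Y p) → B) (ψ : ∀ i, Y.Rep (D i)) (hf : ∀ i p y, (ψ i).ψ p y = Φ i (f ⟨p, y⟩)) :
    ∃ θ : Y.Rep B, ∀ p y, θ.ψ p y = f ⟨p, y⟩ := by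
  have hfe (i : I) (a : A) : (ψ i).ψe a = Φ i (f ⟨0, Y.unit a⟩) := by rw [← hf, (ψ i).ψ_unit]
  let θ (p : P) : Y.Y p →ₗ[ℂ] B :=
    { toFun y := f ⟨p, y⟩
      map_add' x y := hΦ _ _ fun i => by simp only [map_add, ← hf]
      map_smul' c x := hΦ _ _ fun i => by simp only [map_smul, ← hf, RingHom.id_apply] }
  let θe : A →⋆ₙₐ[ℂ] B :=
    { toFun a := f ⟨0, Y.unit a⟩
      map_smul' c a := hΦ _ _ fun i => by rw [← hfe, map_smul, hfe]; exact (map_smul (Φ i) c _).symm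
      map_zero' := hΦ _ _ fun i => by rw [← hfe, map_zero, map_zero]
      map_add' a b := hΦ _ _ fun i => by rw [map_add (Φ i), ← hfe, ← hfe, ← hfe, map_add]
      map_mul' a b := hΦ _ _ fun i => by simp only [_root_.map_mul, ← hfe]
      map_star' a := hΦ _ _ fun i => by simp only [map_star, ← hfe] }
  have hθ (i : I) (p : P) (y : Y.Y p) : Φ i (θ p y) = (ψ i).ψ p y := (hf i p y).symm
  have hθe (i : I) (a : A) : Φ i (θe a) = (ψ i).ψe a := (hfe i a).symm
  refine ⟨⟨θ, θe, fun a => rfl, fun p => .of_map_inner (fun a x => ?_) fun x y => ?_,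
    fun p q x y => ?_⟩, fun p y => rfl⟩
  · exact hΦ _ _ fun i => by rw [_root_.map_mul, hθ, hθ, hθe, ((ψ i).isRep p).map_φ]
  · exact hΦ _ _ fun i => by rw [_root_.map_mul, map_star, hθ, hθ, hθe, ((ψ i).isRep p).map_inner]
  · exact hΦ _ _ fun i => by rw [_root_.map_mul, hθ, hθ, hθ, (ψ i).map_mul]

/-- The relation "being the values of a representation of `Y`" on families indexed by the
elements of `Y`; its universal algebra is the Toeplitz algebra. -/
def relation (Y : ProductSystem P A) : CStarRelation (Σ p, Y.Y p) where
  Holds {B} _ f := ∃ ψ : Y.Rep B, ∀ p y, ψ.ψ p y = f ⟨p, y⟩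
  bound y := ‖y.2‖
  norm_le_bound := by
    rintro B _ f ⟨ψ, hψ⟩ ⟨p, y⟩
    rw [← hψ]
    exact (ψ.isRep p).norm_le y
  of_jointly_injective Φ hΦ f h := by
    choose ψ hψ using h
    exact exists_of_jointly_injective Φ hΦ f ψ hψ

theorem exists_isToeplitz (Y : ProductSystem P A) :
    ∃ (T : Type u) (_ : NonUnitalCStarAlgebra T) (i : Y.Rep T), i.IsToeplitz := by
  obtain ⟨T, _, f, ⟨i, hi⟩, hdense, hlift⟩ := (relation Y).exists_universal
  have himage : {t : T | ∃ p y, t = i.ψ p y} = Set.range f := by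
    simp only [hi, Set.range, Sigma.exists, eq_comm]
  refine ⟨T, inferInstance, i, himage ▸ hdense, fun C _ ψ => ?_⟩
  obtain ⟨Φ, hΦ⟩ := hlift C (fun y => ψ.ψ y.1 y.2) ⟨ψ, fun _ _ => rfl⟩
  exact ⟨Φ, fun p y => (congrArg Φ (hi p y)).trans (hΦ ⟨p, y⟩)⟩

lemma IsToeplitz.hom_ext {i : Y.Rep B} (hi : i.IsToeplitz) {Φ Ψ : B →⋆ₙₐ[ℂ] C}
    (h : i.map Φ = i.map Ψ) : Φ = Ψ := by
  refine starAlgHom_ext_of_dense_adjoin hi.generates ?_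
  rintro _ ⟨p, y, rfl⟩
  exact congrArg (fun ψ : Y.Rep C => ψ.ψ p y) h

end ProductSystem.Rep

namespace C0Sum

variable {V : Type u} {A : V → Type u} [∀ v, NonUnitalCStarAlgebra (A v)] {B : Type u}
  [NonUnitalCStarAlgebra B] (π : ∀ v, A v →⋆ₙₐ[ℂ] B)
  (hπ : Pairwise fun v w => ∀ a b, π v a * π w b = 0)

include hπ in
lemma sum_mul_sum_of_pairwise (F : Finset V) (a b : C0Sum A) :
    (∑ v ∈ F, π v (eval v a)) * ∑ v ∈ F, π v (eval v b) = ∑ v ∈ F, π v (eval v (a * b)) := by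
  rw [Finset.sum_mul_sum]
  refine Finset.sum_congr rfl fun v hv => ?_
  rw [Finset.sum_eq_single_of_mem v hv fun w _ hw => hπ hw.symm _ _, map_mul, map_mul]

include hπ in
lemma norm_sum_le_norm (F : Finset V) (a : C0Sum A) : ‖∑ v ∈ F, π v (eval v a)‖ ≤ ‖a‖ :=
  let πF : C0Sum A →⋆ₙₐ[ℂ] B :=
    { toFun a := ∑ v ∈ F, π v (eval v a)
      map_smul' c a := by simp only [map_smul, Finset.smul_sum, MonoidHom.id_apply]
      map_zero' := by simp only [map_zero, Finset.sum_const_zero]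
      map_add' a b := by simp only [map_add, Finset.sum_add_distrib]
      map_mul' a b := (sum_mul_sum_of_pairwise π hπ F a b).symm
      map_star' a := by simp only [map_star, star_sum] }
  NonUnitalStarAlgHom.norm_apply_le πF a

include hπ in
lemma summable_apply_eval (a : C0Sum A) : Summable fun v => π v (eval v a) := by
  rw [summable_iff_vanishing_norm]
  intro ε hε
  obtain ⟨F, hF⟩ := summable_iff_vanishing_norm.mp
    (LambdaSystem.hasSum_C0Sum a).summable ε hε
  refine ⟨F, fun s hs => lt_of_le_of_lt ?_ (hF s hs)⟩
  have heval (v : V) (hv : v ∈ s) : eval v (∑ w ∈ s, single w (eval w a)) = eval v a := by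
    rw [map_sum, Finset.sum_eq_single_of_mem v hv fun w _ hw => eval_single_ne hw.symm _,
      eval_single_same]
  calc ‖∑ v ∈ s, π v (eval v a)‖ = ‖∑ v ∈ s, π v (eval v (∑ w ∈ s, single w (eval w a)))‖ := by
        rw [Finset.sum_congr rfl fun v hv => congrArg (π v) (heval v hv)]
    _ ≤ ‖∑ w ∈ s, single w (eval w a)‖ := norm_sum_le_norm π hπ s _

/-- The homomorphism `a ↦ ∑ᵥ πᵥ(aᵥ)` on a `c₀`-direct sum defined by homomorphisms with mutually
orthogonal ranges. -/
def lift : C0Sum A →⋆ₙₐ[ℂ] B where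
  toFun a := ∑' v, π v (eval v a)
  map_smul' c a := by
    simp only [map_smul]
    exact (summable_apply_eval π hπ a).tsum_const_smul c
  map_zero' := by simp only [map_zero, tsum_zero]
  map_add' a b := by
    simp only [map_add]
    exact (summable_apply_eval π hπ a).tsum_add (summable_apply_eval π hπ b)
  map_mul' a b := by
    refine tendsto_nhds_unique (summable_apply_eval π hπ (a * b)).hasSum ?_
    have hmul := Tendsto.mul (summable_apply_eval π hπ a).hasSum (summable_apply_eval π hπ b).hasSum
    exact hmul.congr fun F => sum_mul_sum_of_pairwise π hπ F a b
  map_star' a := by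
    simp only [map_star]
    exact tsum_star.symm

lemma hasSum_lift (a : C0Sum A) : HasSum (fun v => π v (eval v a)) (lift π hπ a) :=
  (summable_apply_eval π hπ a).hasSum

lemma lift_single (v : V) (a : A v) : lift π hπ (single v a) = π v a := by
  refine (tsum_eq_single v fun w hw => ?_).trans ?_
  · rw [eval_single_ne hw, map_zero]
  · rw [eval_single_same]

lemma isRep_inflate_lift {v w : V} {E : Corr (A v) (A w)} {t : E →ₗ[ℂ] B}
    (hφ : ∀ a x, t (E.φ a x) = π v a * t x) (hφ_ne : ∀ u, u ≠ v → ∀ a x, π u a * t x = 0)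
    (hinner : ∀ x y, π w (E.inner x y) = star (t x) * t y) :
    (E.inflate).IsRep t (lift π hπ) := by
  refine .of_map_inner (fun a x => ?_) fun x y => (lift_single π hπ w _).trans (hinner x y)
  refine Eq.trans (hφ (eval v a) x) (HasSum.unique ?_ ((hasSum_lift π hπ a).mul_right (t x)))
  exact hasSum_single v fun u hu => hφ_ne u hu _ _

end C0Sum

namespace Corr.L2Sum

section Ext

variable {A B I : Type u} [NonUnitalCStarAlgebra A] [NonUnitalCStarAlgebra B] {E : I → Corr A B}

lemma inner_single (i : I) (x : E i) (y : L2Sum E) :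
    inner (single i x) y = (E i).inner x (y i) := by
  refine (hasSum_inner _ _).unique ?_
  have h := hasSum_single (f := fun j => (E j).inner (single i x j) (y j)) i fun j hj => by
    rw [single_ne hj, ← (E j).star_inner, map_zero, star_zero]
  rwa [single_same] at h

lemma linearMap_ext {V : Type*} [AddCommMonoid V] [TopologicalSpace V] [T2Space V] [Module ℂ V]
    {S T : L2Sum E →ₗ[ℂ] V} (hS : Continuous S) (hT : Continuous T)
    (h : ∀ i x, S (single i x) = T (single i x)) : S = T := by
  refine LinearMap.ext fun x => ((hasSum_single_apply x).map S hS).unique ?_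
  exact ((hasSum_single_apply x).map T hT).congr_fun fun i => h i (x i)

end Ext

section Lift

variable {A B I : Type u} [NonUnitalCStarAlgebra A] [NonUnitalCStarAlgebra B] {E : I → Corr A A}
  (t : ∀ i, E i →ₗ[ℂ] B) {π : A →⋆ₙₐ[ℂ] B} (ht : ∀ i, (E i).IsRep (t i) π)
  (horth : Pairwise fun i j => ∀ x y, star (t i x) * t j y = 0)

include ht horth in
lemma norm_sum_apply_sq_le (F : Finset I) (x : ∀ i, E i) :
    ‖∑ i ∈ F, t i (x i)‖ ^ 2 ≤ ‖∑ i ∈ F, (E i).inner (x i) (x i)‖ := by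
  have hdiag : star (∑ i ∈ F, t i (x i)) * ∑ i ∈ F, t i (x i) =
      π (∑ i ∈ F, (E i).inner (x i) (x i)) := by
    rw [star_sum, Finset.sum_mul_sum, map_sum]
    refine Finset.sum_congr rfl fun i hi => ?_
    rw [Finset.sum_eq_single_of_mem i hi fun j _ hj => horth hj.symm _ _, (ht i).map_inner]
  rw [pow_two, ← CStarRing.norm_star_mul_self, hdiag]
  exact NonUnitalStarAlgHom.norm_apply_le π _

include ht horth in
lemma summable_apply (x : L2Sum E) : Summable fun i => t i (x i) := by
  rw [summable_iff_vanishing_norm]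
  intro ε hε
  obtain ⟨F, hF⟩ := summable_iff_vanishing_norm.mp (summable_inner x x) (ε ^ 2) (by positivity)
  refine ⟨F, fun s hs => lt_of_pow_lt_pow_left₀ 2 hε.le ?_⟩
  exact (norm_sum_apply_sq_le t ht horth s x).trans_lt (hF s hs)

/-- The map `x ↦ ∑ᵢ tᵢ(xᵢ)` on an `ℓ²`-direct sum defined by representations with mutually
orthogonal ranges. -/
def lift : L2Sum E →ₗ[ℂ] B where
  toFun x := ∑' i, t i (x i)
  map_add' x y := by
    simp only [add_apply, map_add]
    exact (summable_apply t ht horth x).tsum_add (summable_apply t ht horth y)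
  map_smul' c x := by
    simp only [smul_apply, map_smul]
    exact (summable_apply t ht horth x).tsum_const_smul c

lemma hasSum_lift (x : L2Sum E) : HasSum (fun i => t i (x i)) (lift t ht horth x) :=
  (summable_apply t ht horth x).hasSum

lemma lift_single (i : I) (x : E i) : lift t ht horth (single i x) = t i x := by
  refine (tsum_eq_single i fun j hj => ?_).trans ?_
  · rw [single_ne hj, map_zero]
  · rw [single_same]

lemma star_apply_mul_lift (i : I) (x : E i) (y : L2Sum E) :
    star (t i x) * lift t ht horth y = π ((E i).inner x (y i)) := by
  rw [(ht i).map_inner]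
  refine ((hasSum_lift t ht horth y).mul_left _).unique ?_
  exact hasSum_single i fun j hj => horth hj.symm _ _

lemma isRep_lift : (l2Sum E).IsRep (lift t ht horth) π := by
  refine .of_map_inner (fun a (x : L2Sum E) => ?_) fun (x y : L2Sum E) => ?_
  · refine (hasSum_lift t ht horth _).unique ?_
    exact ((hasSum_lift t ht horth x).mul_left (π a)).congr_fun fun i => (ht i).map_φ a (x i)
  · refine ((hasSum_inner x y).map π (map_continuous π)).unique ?_
    refine ((hasSum_lift t ht horth x).star.mul_right _).congr_fun fun i => ?_
    exact (star_apply_mul_lift t ht horth i (x i) y).symm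

end Lift

end Corr.L2Sum

section

variable {A B C : Type u} [NonUnitalCStarAlgebra A] [NonUnitalCStarAlgebra B]
  [NonUnitalCStarAlgebra C] {E : Corr A B} {F : Corr B C} {G : Corr A C}

lemma Corr.norm_apply₂_le {m : E →ₗ[ℂ] F →ₗ[ℂ] G}
    (hm : ∀ x y, G.inner (m x y) (m x y) = F.inner y (F.φ (E.inner x x) y)) (x : E) (y : F) :
    ‖m x y‖ ≤ ‖x‖ * ‖y‖ := by
  refine le_of_sq_le_sq ?_ (by positivity)
  calc ‖m x y‖ ^ 2 = ‖F.inner y (F.φ (E.inner x x) y)‖ := by rw [G.norm_sq, hm]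
    _ ≤ ‖y‖ * ‖F.φ (E.inner x x) y‖ := by
      simpa only [← F.norm_eq] using F.isSemiInner.norm_le y (F.φ (E.inner x x) y)
    _ ≤ ‖y‖ * (‖E.inner x x‖ * ‖y‖) := by gcongr; exact F.norm_φ_le _ _
    _ = (‖x‖ * ‖y‖) ^ 2 := by rw [← E.norm_sq]; ring

end

namespace LambdaSystem

variable {k : ℕ} {Λ : Type u} [SmallCategory Λ] {G : KGraph k Λ} {X : LambdaSystem G}
  {B : Type u} [NonUnitalCStarAlgebra B]

section Fibre

variable {m n : Fin k → ℕ}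

lemma inner_incl {v w : Λ} (f : v ⟶ w) (h : G.d f = n) (x : X.X f) (y : X.fibre n) :
    (X.fibre n).inner (X.incl f h x) y = C0Sum.single v ((X.X f).inner x (X.coord f h y)) :=
  Corr.L2Sum.inner_single (E := X.summand n) (.mk f h) x y

lemma unitMap_single (v : Λ) (a : X.A v) :
    X.unitMap (C0Sum.single v a) = X.incl (𝟙 v) (G.d_id v) (X.unit v a) := by
  refine X.fibre_zero_ext fun w => ?_
  rw [coord_unitMap]
  obtain rfl | h := eq_or_ne w v
  · rw [coord_incl_same, C0Sum.eval_single_same]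
  · rw [C0Sum.eval_single_ne h, map_zero, coord_incl_ne]
    exact fun e => h (congrArg (fun l => l.1.src) e)

lemma fibre_linearMap_ext {V : Type*} [AddCommMonoid V] [TopologicalSpace V] [T2Space V]
    [Module ℂ V] {S T : X.fibre n →ₗ[ℂ] V} (hS : Continuous S) (hT : Continuous T)
    (h : ∀ {v w : Λ} (f : v ⟶ w) (hf : G.d f = n) (x : X.X f),
      S (X.incl f hf x) = T (X.incl f hf x)) : S = T :=
  Corr.L2Sum.linearMap_ext (E := X.summand n) hS hT fun l x => h l.1.hom l.2 x

lemma norm_mul_le (x : X.fibre m) (y : X.fibre n) : ‖X.mul m n x y‖ ≤ ‖x‖ * ‖y‖ :=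
  Corr.norm_apply₂_le (fun x y => X.inner_mul x x y y) x y

lemma continuous_mul_right (x : X.fibre m) : Continuous (X.mul m n x) :=
  AddMonoidHomClass.continuous_of_bound _ ‖x‖ fun y => norm_mul_le x y

lemma continuous_mul_left (y : X.fibre n) : Continuous ((X.mul m n).flip y) :=
  AddMonoidHomClass.continuous_of_bound _ ‖y‖ fun x => (norm_mul_le x y).trans_eq (mul_comm _ _)

end Fibre

lemma ψ_ι (ψ : X.productSystem.Rep B) {n : Fin k → ℕ} {v w : Λ} (f : v ⟶ w) (h : G.d f = n)
    (x : X.X f) : ψ.ψ (G.d f) (X.ι f x) = ψ.ψ n (X.incl f h x) := by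
  subst h
  rfl

lemma productSystemRep_ext {φ ψ : X.productSystem.Rep B}
    (h : ∀ {v w : Λ} (f : v ⟶ w) (x : X.X f), φ.ψ (G.d f) (X.ι f x) = ψ.ψ (G.d f) (X.ι f x)) :
    φ = ψ :=
  ProductSystem.Rep.ext_of_ψ fun n =>
    fibre_linearMap_ext (X := X) (φ.isRep n).continuous (ψ.isRep n).continuous fun f hf x =>
      (ψ_ι φ f hf x).symm.trans ((h f x).trans (ψ_ι ψ f hf x))

/-- The representation `(ρ^ψ, π^ψ)` of `X` induced by a representation `ψ` of `Y_X`. -/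
def inducedRep (ψ : X.productSystem.Rep B) : X.Rep B where
  ρ f := ψ.ψ (G.d f) ∘ₗ X.ι f
  π v := ψ.ψe.comp (C0Sum.single v)
  ρ_vertex v a := by
    refine (ψ_ι ψ (𝟙 v) (G.d_id v) (X.unit v a)).trans ?_
    rw [← unitMap_single]
    exact ψ.ψ_unit _
  ρ_mul α β x y := by
    refine (ψ.map_mul _ _ _ _).symm.trans (Eq.trans ?_ (ψ_ι ψ _ (G.d_comp α β) _).symm)
    exact congrArg (ψ.ψ _) (X.incl_mul_incl α β rfl rfl (G.d_comp α β) x y)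
  ρ_mul_eq_zero α β x y hne := by
    refine (ψ.map_mul _ _ _ _).symm.trans ?_
    exact (congrArg (ψ.ψ _) (X.incl_mul_incl_eq_zero α β rfl rfl hne x y)).trans (map_zero _)
  ρ_star_mul α x y := by
    refine ((ψ.isRep _).map_inner _ _).symm.trans ?_
    refine congrArg ψ.ψe ((inner_incl α rfl x _).trans ?_)
    exact congrArg (fun z => C0Sum.single _ ((X.X α).inner x z)) (X.coord_incl_same α rfl y)
  ρ_star_mul_eq_zero α β x y hd hne := by
    refine (congrArg (star (ψ.ψ (G.d α) (X.ι α x)) * ·) (ψ_ι ψ β hd.symm y)).trans ?_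
    refine ((ψ.isRep _).map_inner _ _).symm.trans ?_
    refine (congrArg ψ.ψe ((inner_incl α rfl x _).trans ?_)).trans (map_zero _)
    rw [coord_incl_ne _ _ _ _ _ fun e => hne (congrArg Subtype.val e), map_zero, map_zero]

lemma inducedRep_isInducedBy (ψ : X.productSystem.Rep B) : (inducedRep ψ).IsInducedBy ψ :=
  ⟨fun _ _ => rfl, fun v a => (ψ.ψ_unit (C0Sum.single v a)).symm⟩

namespace Rep

lemma ext_of_ρ {R S : X.Rep B}
    (h : ∀ {v w : Λ} (f : v ⟶ w) (x : X.X f), R.ρ f x = S.ρ f x) : R = S := by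
  have hρ : @Rep.ρ k Λ _ G X B _ R = @Rep.ρ k Λ _ G X B _ S := by
    funext v w f
    exact LinearMap.ext (h f)
  have hπ : R.π = S.π := by
    funext v
    refine NonUnitalStarAlgHom.ext fun a => ?_
    rw [← R.ρ_vertex, ← S.ρ_vertex, h]
  obtain ⟨_, _, _, _, _, _, _⟩ := R
  obtain ⟨_, _, _, _, _, _, _⟩ := S
  obtain rfl := hρ
  obtain rfl := hπ
  rfl

variable (R : X.Rep B)

lemma pairwise_π_mul_π : Pairwise fun v w => ∀ (a : X.A v) (b : X.A w), R.π v a * R.π w b = 0 := by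
  intro v w h a b
  rw [← R.ρ_vertex, ← R.ρ_vertex]
  exact R.ρ_mul_eq_zero _ _ _ _ h

lemma π_mul_ρ_of_ne {u v w : Λ} (f : v ⟶ w) (h : u ≠ w) (a : X.A u) (x : X.X f) :
    R.π u a * R.ρ f x = 0 := by
  rw [← R.ρ_vertex]
  exact R.ρ_mul_eq_zero _ _ _ _ h

lemma ρ_φ {v w : Λ} (f : v ⟶ w) (a : X.A w) (x : X.X f) :
    R.ρ f ((X.X f).φ a x) = R.π w a * R.ρ f x := by
  rw [← R.ρ_vertex, R.ρ_mul]
  exact congrArg (fun p : Σ g : v ⟶ w, X.X g => R.ρ p.1 p.2) (X.χ_left f a x).symm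

lemma pairwise_star_ρ_mul_ρ (n : Fin k → ℕ) : Pairwise fun l l' : G.PathOf n =>
    ∀ (x : X.X l.1.hom) (y : X.X l'.1.hom), star (R.ρ l.1.hom x) * R.ρ l'.1.hom y = 0 :=
  fun l l' h _ _ =>
    R.ρ_star_mul_eq_zero _ _ _ _ (l.2.trans l'.2.symm) fun e => h (Subtype.ext e)

/-- The homomorphism `⨁ᵥ Aᵥ → B` with components `πᵥ`. -/
def sumπ : X.algA →⋆ₙₐ[ℂ] B := C0Sum.lift R.π R.pairwise_π_mul_π

lemma isRep_ρ {n : Fin k → ℕ} (l : G.PathOf n) : (X.summand n l).IsRep (R.ρ l.1.hom) R.sumπ :=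
  C0Sum.isRep_inflate_lift R.π R.pairwise_π_mul_π (R.ρ_φ _)
    (fun _ hu => R.π_mul_ρ_of_ne _ hu) fun x y => (R.ρ_star_mul _ x y).symm

/-- The map `Yₙ → B` with components `ρ_λ`. -/
def sumρ (n : Fin k → ℕ) : X.fibre n →ₗ[ℂ] B :=
  Corr.L2Sum.lift (E := X.summand n) (fun l => R.ρ l.1.hom) R.isRep_ρ (R.pairwise_star_ρ_mul_ρ n)

lemma isRep_sumρ (n : Fin k → ℕ) : (X.fibre n).IsRep (R.sumρ n) R.sumπ :=
  Corr.L2Sum.isRep_lift (E := X.summand n) _ R.isRep_ρ (R.pairwise_star_ρ_mul_ρ n)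

lemma sumρ_incl {n : Fin k → ℕ} {v w : Λ} (f : v ⟶ w) (h : G.d f = n) (x : X.X f) :
    R.sumρ n (X.incl f h x) = R.ρ f x :=
  Corr.L2Sum.lift_single (E := X.summand n) _ R.isRep_ρ _ (.mk f h) x

lemma sumρ_incl_mul_incl {m n : Fin k → ℕ} {u v v' w : Λ} (α : v ⟶ w) (β : u ⟶ v')
    (hα : G.d α = m) (hβ : G.d β = n) (x : X.X α) (y : X.X β) :
    R.sumρ (m + n) (X.mul m n (X.incl α hα x) (X.incl β hβ y)) = R.ρ α x * R.ρ β y := by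
  obtain rfl | h := eq_or_ne v v'
  · rw [X.incl_mul_incl α β hα hβ (by rw [G.d_comp, hα, hβ]), R.sumρ_incl, R.ρ_mul]
  · rw [X.incl_mul_incl_eq_zero α β hα hβ h, map_zero, R.ρ_mul_eq_zero _ _ _ _ h]

lemma sumρ_mul {m n : Fin k → ℕ} (x : X.fibre m) (y : X.fibre n) :
    R.sumρ (m + n) (X.mul m n x y) = R.sumρ m x * R.sumρ n y := by
  have hρ (p : Fin k → ℕ) : Continuous (R.sumρ p) := (R.isRep_sumρ p).continuous
  have h_incl {v w : Λ} (α : v ⟶ w) (hα : G.d α = m) (x : X.X α) :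
      R.sumρ (m + n) ∘ₗ X.mul m n (X.incl α hα x) = LinearMap.mulLeft ℂ (R.ρ α x) ∘ₗ R.sumρ n :=
    fibre_linearMap_ext ((hρ _).comp (continuous_mul_right _)) (continuous_const.mul (hρ n))
      fun β hβ y => (R.sumρ_incl_mul_incl α β hα hβ x y).trans
        (congrArg (R.ρ α x * ·) (R.sumρ_incl β hβ y).symm)
  have h : R.sumρ (m + n) ∘ₗ (X.mul m n).flip y =
      LinearMap.mulRight ℂ (R.sumρ n y) ∘ₗ R.sumρ m :=
    fibre_linearMap_ext ((hρ _).comp (continuous_mul_left y)) ((hρ m).mul continuous_const)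
      fun α hα x => (LinearMap.congr_fun (h_incl α hα x) y).trans
        (congrArg (· * R.sumρ n y) (R.sumρ_incl α hα x).symm)
  exact LinearMap.congr_fun h x

lemma sumρ_unitMap (a : X.algA) : R.sumρ 0 (X.unitMap a) = R.sumπ a := by
  refine (Corr.L2Sum.hasSum_lift (E := X.summand 0) _ _ _ _).unique ?_
  rw [← (vertexEquiv G).hasSum_iff]
  exact (C0Sum.hasSum_lift _ _ a).congr_fun fun v => R.ρ_vertex v _

/-- The representation `ψ^{(ρ, π)}` of `Y_X` determined by a representation `(ρ, π)` of `X`. -/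
def toProductSystem : X.productSystem.Rep B where
  ψ := R.sumρ
  ψe := R.sumπ
  ψ_unit := R.sumρ_unitMap
  isRep := R.isRep_sumρ
  map_mul _ _ := R.sumρ_mul

lemma toProductSystem_ι {v w : Λ} (f : v ⟶ w) (x : X.X f) :
    R.toProductSystem.ψ (G.d f) (X.ι f x) = R.ρ f x :=
  R.sumρ_incl f rfl x

theorem isUniversal_of_isToeplitz {T : Type u} [NonUnitalCStarAlgebra T]
    {i : X.productSystem.Rep T} (hi : i.IsToeplitz) {R : X.Rep T} (hR : R.IsInducedBy i) :
    R.IsUniversal := by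
  intro C _ R'
  obtain ⟨Φ, hΦ⟩ := hi.lift C R'.toProductSystem
  have hρ {v w : Λ} (f : v ⟶ w) (x : X.X f) : Φ (R.ρ f x) = R'.ρ f x :=
    (congrArg Φ (hR.1 f x)).trans ((hΦ _ _).trans (R'.toProductSystem_ι f x))
  refine ⟨Φ, ⟨hρ, fun v a => ?_⟩, fun Ψ hΨ => hi.hom_ext (productSystemRep_ext fun f x => ?_)⟩
  · rw [← R.ρ_vertex, hρ, R'.ρ_vertex]
  · calc Ψ (i.ψ _ (X.ι f x)) = Ψ (R.ρ f x) := congrArg Ψ (hR.1 f x).symm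
      _ = Φ (R.ρ f x) := (hΨ.1 f x).trans (hρ f x).symm
      _ = Φ (i.ψ _ (X.ι f x)) := congrArg Φ (hR.1 f x)

end Rep

/-- The correspondence `ψ ↦ (ρ^ψ, π^ψ)` between representations of `Y_X` and of `X`, with inverse
`(ρ, π) ↦ ψ^{(ρ, π)}`. -/
def repEquiv (X : LambdaSystem G) (B : Type u) [NonUnitalCStarAlgebra B] :
    X.productSystem.Rep B ≃ X.Rep B where
  toFun := inducedRep
  invFun := Rep.toProductSystem
  left_inv ψ := productSystemRep_ext (inducedRep ψ).toProductSystem_ι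
  right_inv R := Rep.ext_of_ρ R.toProductSystem_ι

end LambdaSystem

end

theorem proposition3p2p3_general {k : ℕ} {Λ : Type u} [SmallCategory Λ] (G : KGraph k Λ)
    (X : LambdaSystem G) :
    (∀ (B : Type u) [NonUnitalCStarAlgebra B],
      ∃ e : X.productSystem.Rep B ≃ X.Rep B,
        (∀ ψ : X.productSystem.Rep B, (e ψ).IsInducedBy ψ) ∧
        (∀ R : X.Rep B,
          (∀ {v w : Λ} (f : v ⟶ w) (x : X.X f), (e.symm R).ψ (G.d f) (X.ι f x) = R.ρ f x) ∧
          ∀ ψ : X.productSystem.Rep B,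
            (∀ {v w : Λ} (f : v ⟶ w) (x : X.X f), ψ.ψ (G.d f) (X.ι f x) = R.ρ f x) →
              ψ = e.symm R)) ∧
    (∃ (T : Type u) (_ : NonUnitalCStarAlgebra T) (i : X.productSystem.Rep T), i.IsToeplitz) ∧
    (∀ (T : Type u) [NonUnitalCStarAlgebra T] (i : X.productSystem.Rep T), i.IsToeplitz →
      ∀ R : X.Rep T, R.IsInducedBy i → R.IsUniversal) :=
  ⟨fun B _ => ⟨X.repEquiv B, LambdaSystem.inducedRep_isInducedBy, fun R =>
      ⟨R.toProductSystem_ι, fun _ hψ => LambdaSystem.productSystemRep_ext fun f x =>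
        (hψ f x).trans (R.toProductSystem_ι f x).symm⟩⟩,
    ProductSystem.Rep.exists_isToeplitz _,
    fun _ _ _ hi _ hR => LambdaSystem.Rep.isUniversal_of_isToeplitz hi hR⟩

theorem proposition3p2p3 {k : ℕ} {Λ : Type u} [SmallCategory Λ] (G : KGraph k Λ)
    (X : LambdaSystem G) (hX : X.IsRegular) :
    (∀ (B : Type u) [NonUnitalCStarAlgebra B],
      ∃ e : X.productSystem.Rep B ≃ X.Rep B,
        (∀ ψ : X.productSystem.Rep B, (e ψ).IsInducedBy ψ) ∧
        (∀ R : X.Rep B,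
          (∀ {v w : Λ} (f : v ⟶ w) (x : X.X f), (e.symm R).ψ (G.d f) (X.ι f x) = R.ρ f x) ∧
          ∀ ψ : X.productSystem.Rep B,
            (∀ {v w : Λ} (f : v ⟶ w) (x : X.X f), ψ.ψ (G.d f) (X.ι f x) = R.ρ f x) →
              ψ = e.symm R)) ∧
    (∃ (T : Type u) (_ : NonUnitalCStarAlgebra T) (i : X.productSystem.Rep T), i.IsToeplitz) ∧
    (∀ (T : Type u) [NonUnitalCStarAlgebra T] (i : X.productSystem.Rep T), i.IsToeplitz →
      ∀ R : X.Rep T, R.IsInducedBy i → R.IsUniversal) :=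
  proposition3p2p3_general G X
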